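/- Fix $N$ experts and tasks $1,\dots,T$. Task $t$ has a hidden state $Y(t)\in\{-1,1\}$ with $\mathbb P(Y(t)=1)=\mathbb P(Y(t)=-1)=\tfrac12$, and expert $i$ gives an opinion $X_i(t)\in\{-1,1\}$ on it. Given $Y(t)$ the opinions $X_1(t),\dots,X_N(t)$ are conditionally independent, and $\mathbb P(X_i(t)=Y(t)\mid Y(t)=y)=p_i$ for both $y\in\{-1,1\}$ and every task $t$, where $p\in[0,1]^N$ is arbitrary. Different tasks are independent. Let $V(\mathbf X_{\setminus i}(t))$ be the sign of $\sum_{j\ne i}X_j(t)$ (majority vote of the peers of $i$). Every sign takes values in $\{-1,1\}$, and ties are broken by arbitrary, possibly random, values in $\{-1,1\}$; those used on task $t$ are independent of $(Y(t),\mathbf X(t))$ and belong to task $t$ (so they are independent of the other tasks). Define the pseudo competence and the empirical pseudo competence after $\tau$ tasks by $$\tilde p_i=\mathbb P\big(X_i(t)=V(\mathbf X_{\setminus i}(t))\big),\qquad \tilde p_i(\tau)=\frac1\tau\sum_{s=1}^{\tau}\mathbf 1\{X_i(s)=V(\mathbf X_{\setminus i}(s))\},$$ where $\tilde p_i$ does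 not depend on $t$. With weights frozen after $\tau$ tasks, define the adaptive rule $$f^A_\tau(\mathbf x)=\operatorname{sign}\Big(\sum_{i=1}^N x_i\log\frac{\tilde p_i(\tau)}{1-\tilde p_i(\tau)}\Big),$$ where the logarithm is $-\infty$ at $\tilde p_i(\tau)=0$ and $+\infty$ at $\tilde p_i(\tau)=1$, and a sum of the form $\infty-\infty$ counts as a tie. Let $\tau\ge 1$, let $\delta\ge\sum_{i=1}^N|p_i-\tilde p_i|+\frac{N}{\sqrt\tau}$, and let $R(\tau)$ be the event $$\exp\Big(-\frac12\sum_{i=1}^N\Big(\tilde p_i(\tau)-\frac12\Big)\log\frac{\tilde p_i(\tau)}{1-\tilde p_i(\tau)}\Big)\le\frac\delta2,$$ where the sum is $+\infty$ and its exponential is $0$ if some $\tilde p_i(\tau)\in\{0,1\}$. Then for every task $t$ with $\tau<t\le T$, $$\mathbb P\big(R(\tau)\cap\{f^A_\tau(\mathbf X(t))\ne Y(t)\}\big)\le\delta .$$ -/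

import Mathlib

open MeasureTheory ProbabilityTheory

/-- The sign of an integer with values in `{-1, 1}`; the value `tie` is used at zero. -/
def signTie (s tie : ℤ) : ℤ :=
  if 0 < s then 1 else if s < 0 then -1 else tie

/-- The majority vote of all experts other than `i` on the opinions `x`, ties going to `tie`. -/
def peerVote {N : ℕ} (x : Fin N → ℤ) (i : Fin N) (tie : ℤ) : ℤ :=
  signTie (∑ j ∈ Finset.univ.erase i, x j) tie

/-- The model of stochastic experts with competences `p` on the tasks `1, …, T`.
`Y t` is the hidden state of task `t`, `X i t` the opinion of expert `i` on task `t`.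
`U i t` is the value in `{-1, 1}` given to a tie among the peers of expert `i` on task `t`, and
`C t` the value given to a tie of the aggregation rule on task `t`. The tie values are arbitrary
(constant or randomized), but they carry no information on the states and the opinions. -/
structure IsExpertModel {Ω : Type*} [MeasurableSpace Ω] (P : Measure Ω) {N : ℕ} (T : ℕ)
    (p : Fin N → ℝ) (Y : ℕ → Ω → ℤ) (X : Fin N → ℕ → Ω → ℤ)
    (U : Fin N → ℕ → Ω → ℤ) (C : ℕ → Ω → ℤ) : Prop where
  measurable_state : ∀ t ∈ Finset.Icc 1 T, Measurable (Y t)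
  measurable_opinion : ∀ i, ∀ t ∈ Finset.Icc 1 T, Measurable (X i t)
  measurable_voteTie : ∀ i, ∀ t ∈ Finset.Icc 1 T, Measurable (U i t)
  measurable_ruleTie : ∀ t ∈ Finset.Icc 1 T, Measurable (C t)
  state_mem : ∀ t ∈ Finset.Icc 1 T, ∀ ω, Y t ω = -1 ∨ Y t ω = 1
  opinion_mem : ∀ i, ∀ t ∈ Finset.Icc 1 T, ∀ ω, X i t ω = -1 ∨ X i t ω = 1
  voteTie_mem : ∀ i, ∀ t ∈ Finset.Icc 1 T, ∀ ω, U i t ω = -1 ∨ U i t ω = 1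
  ruleTie_mem : ∀ t ∈ Finset.Icc 1 T, ∀ ω, C t ω = -1 ∨ C t ω = 1
  /-- The prior of the states is uniform. -/
  uniform_prior : ∀ t ∈ Finset.Icc 1 T,
    P.real {ω | Y t ω = 1} = 1 / 2 ∧ P.real {ω | Y t ω = -1} = 1 / 2
  /-- Expert `i` identifies the state with probability `p i`, on every task and in either state. -/
  competence : ∀ i, ∀ t ∈ Finset.Icc 1 T, ∀ y : ℤ, y = -1 ∨ y = 1 →
    (P[|{ω | Y t ω = y}]).real {ω | X i t ω = Y t ω} = p i
  /-- The opinions on a task are conditionally independent given the state. -/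
  opinions_condIndep : ∀ t ∈ Finset.Icc 1 T, ∀ y : ℤ, y = -1 ∨ y = 1 →
    iIndepFun (fun i => X i t) (P[|{ω | Y t ω = y}])
  /-- The tie values of a task are independent of its state and opinions. -/
  ties_indep : ∀ t ∈ Finset.Icc 1 T,
    IndepFun (fun ω => (Y t ω, fun i => X i t ω)) (fun ω => (C t ω, fun i => U i t ω)) P
  /-- Different tasks are independent. -/
  tasks_indep : iIndepFun (fun (t : Finset.Icc 1 T) ω =>
    ((Y t ω, fun i => X i t ω), (C t ω, fun i => U i t ω))) P

/-- The pseudo competence of expert `i` (read off task `t`): the probability that the expert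
agrees with the majority vote of the other experts. -/
noncomputable def pseudoCompetence {Ω : Type*} [MeasurableSpace Ω] (P : Measure Ω) {N : ℕ}
    (X U : Fin N → ℕ → Ω → ℤ) (i : Fin N) (t : ℕ) : ℝ :=
  P.real {ω | X i t ω = peerVote (fun j => X j t ω) i (U i t ω)}

/-- The empirical pseudo competence of expert `i` after `τ` tasks: the fraction of the tasks
`1, …, τ` on which the expert agrees with the majority vote of the other experts. -/
noncomputable def empiricalPseudoCompetence {Ω : Type*} {N : ℕ}
    (X U : Fin N → ℕ → Ω → ℤ) (τ : ℕ) (ω : Ω) (i : Fin N) : ℝ :=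
  (∑ s ∈ Finset.Icc 1 τ,
    if X i s ω = peerVote (fun j => X j s ω) i (U i s ω) then (1 : ℝ) else 0) / τ

/-- The weight `log (q / (1 - q))` of a competence `q ∈ [0, 1]`, equal to `-∞` at `q = 0` and to
`+∞` at `q = 1`. -/
noncomputable def naiveBayesWeight (q : ℝ) : EReal :=
  ENNReal.log (ENNReal.ofReal q / ENNReal.ofReal (1 - q))

/-- The committee potential `∑ i, (q i - 1/2) log (q i / (1 - q i))`, with values in `[0, ∞]`. -/
noncomputable def committeePotential {N : ℕ} (q : Fin N → ℝ) : EReal :=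
  ∑ i, ((q i - 1 / 2 : ℝ) : EReal) * naiveBayesWeight (q i)

/-- The weighted vote `sign (∑ i, x i * w i)`. The sums of the positive and of the negative parts
of the terms are compared; they can be infinite, and the value `tie` is used when they are equal
(which includes the undefined case `∞ - ∞`). -/
noncomputable def weightedVote {N : ℕ} (w : Fin N → EReal) (x : Fin N → ℤ) (tie : ℤ) : ℤ :=
  if ∑ i, (-(((x i : ℝ) : EReal) * w i)).toENNReal < ∑ i, (((x i : ℝ) : EReal) * w i).toENNReal
  then 1
  else if ∑ i, (((x i : ℝ) : EReal) * w i).toENNReal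
    < ∑ i, (-(((x i : ℝ) : EReal) * w i)).toENNReal
  then -1
  else tie

/-- The adaptive rule with its weights frozen after `τ` tasks, on the opinions `x`. -/
noncomputable def adaptiveRule {Ω : Type*} {N : ℕ} (X U : Fin N → ℕ → Ω → ℤ) (τ : ℕ) (ω : Ω)
    (x : Fin N → ℤ) (tie : ℤ) : ℤ :=
  weightedVote (fun i => naiveBayesWeight (empiricalPseudoCompetence X U τ ω i)) x tie

/-- The event `R(τ)`: `exp (-Φ/2) ≤ δ/2` for the empirical pseudo committee potential `Φ` after
`τ` tasks, where `exp (-∞) = 0`. -/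
noncomputable def confidenceEvent {Ω : Type*} {N : ℕ} (X U : Fin N → ℕ → Ω → ℤ) (τ : ℕ)
    (δ : ℝ) : Set Ω :=
  {ω | EReal.exp (((-(1 / 2) : ℝ) : EReal) *
      committeePotential (empiricalPseudoCompetence X U τ ω)) ≤ ENNReal.ofReal (δ / 2)}

/-! Put `m i = p i - 1/2`. By the symmetry of the two states, everything can be computed for the
vector of signs that tells which experts are right; its coordinates are independent with means `2 m
i`. If `g i` is half the mean majority sign of the peers of `i` (`peerBias`), the pseudo competence
is `1/2 + 2 m i g i`, so the total defect is `A = ∑ |m i| (1 - 2 g i)`.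

The weights depend only on the first `τ` tasks, hence are independent of task `t`. With them fixed
at the empirical values `q i = 1/2 + e i`, where `e i = 2 m i g i + r i`, the key bound is
`signMean_voteErr_le`: on the confidence event and for `δ < 1`, the error is at most `δ/4 + (3/4) A
+ ∑ deviationCost (m i) (r i)`. The deviation `r i` has mean zero and mean modulus at most `1 / (2
√τ)`, and the deviation cost is `3/2 |r i|` plus a linear term, so averaging gives `δ/4 + 3/4 (A +
N/√τ) ≤ δ`.

For the key bound, compare the true parameters `m` with the parameters `e` for which the weights are
ideal. With parameters `e` the error is at most half of `∏ √(1 - 4 e²)`, which is at most half of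
`exp (-Φ/2)`, hence at most `δ/4`. The expected error is affine in each parameter, and being right
more often can only help a voter whose weight is nonnegative. Thus a voter with `m i e i ≥ 0` is
replaced at a cost caused only by overestimation, which its deviation pays for.

The difficulty is the set `W` of voters with `m i e i < 0`. Replacing one of them costs `|m i| + |e
i| = A i + y i`, where `y i` is a deviation that costs at least `y i`. If the surplus of the
deviation costs covers a quarter of the defect on `W`, replacing everybody suffices. Otherwise only
the voters off `W` are replaced, and the vote is bounded with an arbitrary law on `W`
(`signMean_errSign_le`); the price is a factor, which `prod_correction_mul_le` bounds by `1 + 3 ∑ A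
i + 4 ∑ deviationCost` over `W`. This needs `|e i|` to be hardly larger than `1/4`, which follows
from `defectSlack_nonneg`: peers of `j` that lean the wrong way force a total defect of at least `|m
j| - 2 g j`. That inequality fails for two voters; but then the empirical weights coincide, a
disagreement is a tie, and every influence is halved. -/

set_option linter.unusedSectionVars false

/-! ### Expectations over independent signs, affine in each parameter. -/

section SignVectors

variable {ι : Type*} [Fintype ι] [DecidableEq ι]

/-- The real value `± 1` of a sign. -/
def signVal (u : ℤˣ) : ℝ := ((u : ℤ) : ℝ)

@[simp] lemma signVal_one : signVal 1 = 1 := by simp [signVal]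

@[simp] lemma signVal_neg (u : ℤˣ) : signVal (-u) = -signVal u := by simp [signVal]

@[simp] lemma signVal_mul (u v : ℤˣ) : signVal (u * v) = signVal u * signVal v := by
  simp [signVal]

lemma signVal_eq (u : ℤˣ) : signVal u = 1 ∨ signVal u = -1 := by
  rcases Int.units_eq_one_or u with rfl | rfl <;> simp

lemma sum_sign (f : ℤˣ → ℝ) : ∑ u, f u = f 1 + f (-1) := by
  rw [UnitsInt.univ, Finset.sum_pair (by decide)]

lemma sum_prod_sign (f : ι → ℤˣ → ℝ) :
    ∑ x : ι → ℤˣ, ∏ i, f i (x i) = ∏ i, (f i 1 + f i (-1)) := by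
  simp_rw [← sum_sign]
  rw [Finset.prod_univ_sum, Fintype.piFinset_univ]

/-- The probability of the sign vector `x` if its coordinates are independent with means `2 m i`. -/
noncomputable def signMass (m : ι → ℝ) (x : ι → ℤˣ) : ℝ := ∏ i, (1 / 2 + m i * signVal (x i))

/-- The factor of `signMass` that comes from the coordinates other than `k`. -/
noncomputable def restMass (m : ι → ℝ) (k : ι) (x : ι → ℤˣ) : ℝ :=
  ∏ i ∈ Finset.univ.erase k, (1 / 2 + m i * signVal (x i))

/-- The expectation of `F` on sign vectors with independent coordinates of means `2 m i`. -/
noncomputable def signMean (m : ι → ℝ) (F : (ι → ℤˣ) → ℝ) : ℝ := ∑ x, signMass m x * F x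

/-- The sign vector `x` with the coordinate `k` reversed. -/
def flipAt (k : ι) (x : ι → ℤˣ) : ι → ℤˣ := Function.update x k (-x k)

lemma flipAt_flipAt (k : ι) (x : ι → ℤˣ) : flipAt k (flipAt k x) = x := by
  simp [flipAt]

@[simp] lemma flipAt_same (k : ι) (x : ι → ℤˣ) : flipAt k x k = -x k := by simp [flipAt]

lemma flipAt_of_ne {k i : ι} (h : i ≠ k) (x : ι → ℤˣ) : flipAt k x i = x i := by
  simp [flipAt, h]

lemma sum_flipAt (k : ι) (f : (ι → ℤˣ) → ℝ) : ∑ x, f (flipAt k x) = ∑ x, f x :=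
  Fintype.sum_bijective _ (Function.Involutive.bijective (flipAt_flipAt k)) _ _ fun _ => rfl

lemma sum_mul_left_sign (s : ι → ℤˣ) (f : (ι → ℤˣ) → ℝ) : ∑ x, f (s * x) = ∑ x, f x :=
  Fintype.sum_bijective _ (Group.mulLeft_bijective s) _ _ fun _ => rfl

lemma half_add_mul_signVal_nonneg {a : ℝ} (h : |a| ≤ 1 / 2) (u : ℤˣ) :
    0 ≤ 1 / 2 + a * signVal u := by
  have := abs_le.1 h
  rcases signVal_eq u with h | h <;> rw [h] <;> linarith

lemma signMass_nonneg {m : ι → ℝ} (hm : ∀ i, |m i| ≤ 1 / 2) (x : ι → ℤˣ) : 0 ≤ signMass m x :=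
  Finset.prod_nonneg fun i _ => half_add_mul_signVal_nonneg (hm i) _

lemma restMass_nonneg {m : ι → ℝ} (k : ι) (hm : ∀ i, i ≠ k → |m i| ≤ 1 / 2) (x : ι → ℤˣ) :
    0 ≤ restMass m k x :=
  Finset.prod_nonneg fun i hi => half_add_mul_signVal_nonneg (hm i (Finset.ne_of_mem_erase hi)) _

lemma sum_signMass (m : ι → ℝ) : ∑ x, signMass m x = 1 := by
  unfold signMass
  rw [sum_prod_sign fun i u => 1 / 2 + m i * signVal u]
  refine Finset.prod_eq_one fun i _ => ?_
  simp; ring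

lemma signMass_eq (m : ι → ℝ) (k : ι) (x : ι → ℤˣ) :
    signMass m x = (1 / 2 + m k * signVal (x k)) * restMass m k x :=
  (Finset.mul_prod_erase _ _ (Finset.mem_univ k)).symm

lemma restMass_flipAt (m : ι → ℝ) (k : ι) (x : ι → ℤˣ) :
    restMass m k (flipAt k x) = restMass m k x :=
  Finset.prod_congr rfl fun i hi => by rw [flipAt_of_ne (Finset.ne_of_mem_erase hi)]

lemma restMass_update (m : ι → ℝ) (k : ι) (a : ℝ) (x : ι → ℤˣ) :
    restMass (Function.update m k a) k x = restMass m k x :=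
  Finset.prod_congr rfl fun i hi => by
    rw [Function.update_of_ne (Finset.ne_of_mem_erase hi)]

/-- The expectation is affine in each of the parameters. -/
lemma signMean_eq (m : ι → ℝ) (k : ι) (F : (ι → ℤˣ) → ℝ) :
    signMean m F = (1 / 2) * ∑ x, restMass m k x * F x
      + m k * ∑ x, restMass m k x * (signVal (x k) * F x) := by
  unfold signMean
  rw [Finset.mul_sum, Finset.mul_sum, ← Finset.sum_add_distrib]
  refine Finset.sum_congr rfl fun x _ => ?_
  rw [signMass_eq m k]; ring

lemma signMean_update (m : ι → ℝ) (k : ι) (a : ℝ) (F : (ι → ℤˣ) → ℝ) :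
    signMean (Function.update m k a) F = (1 / 2) * ∑ x, restMass m k x * F x
      + a * ∑ x, restMass m k x * (signVal (x k) * F x) := by
  rw [signMean_eq _ k]
  simp only [restMass_update, Function.update_self]

/-- Both signs of the free coordinate `k` are counted, hence the total 2 and not 1. -/
lemma sum_restMass (m : ι → ℝ) (k : ι) : ∑ x, restMass m k x = 2 := by
  have h := signMean_update m k 0 fun _ => 1
  have h2 : signMean (Function.update m k 0) (fun _ => 1) = 1 := by
    simp [signMean, sum_signMass]
  simp only [mul_one, zero_mul, add_zero] at h
  linarith

lemma signMean_const (m : ι → ℝ) (c : ℝ) : signMean m (fun _ => c) = c := by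
  rw [signMean, ← Finset.sum_mul, sum_signMass, one_mul]

lemma signMean_mono {m : ι → ℝ} (hm : ∀ i, |m i| ≤ 1 / 2) {F G : (ι → ℤˣ) → ℝ}
    (h : ∀ x, F x ≤ G x) : signMean m F ≤ signMean m G :=
  Finset.sum_le_sum fun x _ => mul_le_mul_of_nonneg_left (h x) (signMass_nonneg hm x)

/-- Pairing `x` with `flipAt k x` turns the slope of the expectation in `m k` into an average of the
influences of coordinate `k`; bounds on the influence thus become bounds on the slope. -/
lemma sum_restMass_signVal (m : ι → ℝ) (k : ι) (F : (ι → ℤˣ) → ℝ) :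
    ∑ x, restMass m k x * (signVal (x k) * F x)
      = (1 / 2) * ∑ x, restMass m k x * (signVal (x k) * (F x - F (flipAt k x))) := by
  have h := sum_flipAt k fun x => restMass m k x * (signVal (x k) * F x)
  simp only [restMass_flipAt, flipAt_same, signVal_neg] at h
  have h2 : ∑ x, restMass m k x * (signVal (x k) * (F x - F (flipAt k x)))
      = ∑ x, restMass m k x * (signVal (x k) * F x)
        + ∑ x, restMass m k x * (-signVal (x k) * F (flipAt k x)) := by
    rw [← Finset.sum_add_distrib]
    exact Finset.sum_congr rfl fun x _ => by ring
  rw [h2, h]; ring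

/-- The expectation of a function of the other coordinates does not depend on `m k`. -/
lemma signMean_update_of_indep (m : ι → ℝ) (k : ι) (a : ℝ) {F : (ι → ℤˣ) → ℝ}
    (hF : ∀ x, F (flipAt k x) = F x) : signMean (Function.update m k a) F = signMean m F := by
  rw [signMean_update, signMean_eq m k, sum_restMass_signVal]
  simp [hF]

lemma signMean_signVal_mul (m : ι → ℝ) (k : ι) {F : (ι → ℤˣ) → ℝ}
    (hF : ∀ x, F (flipAt k x) = F x) :
    signMean m (fun x => signVal (x k) * F x) = 2 * m k * signMean m F := by
  rw [signMean_eq m k, signMean_eq m k F, sum_restMass_signVal m k F]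
  have : ∀ x : ι → ℤˣ, signVal (x k) * (signVal (x k) * F x) = F x := fun x => by
    rcases signVal_eq (x k) with h | h <;> rw [h] <;> ring
  simp only [this, hF]
  simp; ring

/-- Changing one parameter changes the expectation by at most the influence of that coordinate. -/
lemma exists_signMean_eq_update_add {m : ι → ℝ} (k : ι) (hm : ∀ i, i ≠ k → |m i| ≤ 1 / 2) (a : ℝ)
    {F : (ι → ℤˣ) → ℝ} {lo hi : ℝ}
    (hlo : ∀ x, lo ≤ signVal (x k) * (F x - F (flipAt k x)))
    (hhi : ∀ x, signVal (x k) * (F x - F (flipAt k x)) ≤ hi) :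
    ∃ β, lo ≤ β ∧ β ≤ hi ∧
      signMean m F = signMean (Function.update m k a) F + (m k - a) * β := by
  refine ⟨∑ x, restMass m k x * (signVal (x k) * F x), ?_, ?_, ?_⟩
  · rw [sum_restMass_signVal]
    have : ∑ x, restMass m k x * lo
        ≤ ∑ x, restMass m k x * (signVal (x k) * (F x - F (flipAt k x))) :=
      Finset.sum_le_sum fun x _ => mul_le_mul_of_nonneg_left (hlo x) (restMass_nonneg k hm x)
    rw [← Finset.sum_mul, sum_restMass] at this
    linarith
  · rw [sum_restMass_signVal]
    have : ∑ x, restMass m k x * (signVal (x k) * (F x - F (flipAt k x)))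
        ≤ ∑ x, restMass m k x * hi :=
      Finset.sum_le_sum fun x _ => mul_le_mul_of_nonneg_left (hhi x) (restMass_nonneg k hm x)
    rw [← Finset.sum_mul, sum_restMass] at this
    linarith
  · rw [signMean_eq m k, signMean_update]; ring

end SignVectors

/-! ### Majority of the peers, and a lower bound for the total defect of the pseudo competences. -/

section PeerMajority

variable {ι : Type*} [Fintype ι] [DecidableEq ι]

/-- The sum of the signs other than the one of `k`. -/
def peerSum (k : ι) (x : ι → ℤˣ) : ℤ := ∑ i ∈ Finset.univ.erase k, (x i : ℤ)

/-- The majority sign of the coordinates other than `k`, zero for a tie. -/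
def peerSign (k : ι) (x : ι → ℤˣ) : ℝ := ((peerSum k x).sign : ℝ)

/-- Half the expected majority sign of the coordinates other than `k`. -/
noncomputable def peerBias (m : ι → ℝ) (k : ι) : ℝ := signMean m (peerSign k) / 2

lemma peerSum_flipAt (k : ι) (x : ι → ℤˣ) : peerSum k (flipAt k x) = peerSum k x :=
  Finset.sum_congr rfl fun i hi => by rw [flipAt_of_ne (Finset.ne_of_mem_erase hi)]

lemma peerSign_flipAt (k : ι) (x : ι → ℤˣ) : peerSign k (flipAt k x) = peerSign k x := by
  rw [peerSign, peerSum_flipAt, peerSign]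

lemma intSign_cases (a : ℤ) :
    (0 < a ∧ a.sign = 1) ∨ (a = 0 ∧ a.sign = 0) ∨ (a < 0 ∧ a.sign = -1) := by
  rcases lt_trichotomy a 0 with h | h | h
  · exact Or.inr (Or.inr ⟨h, Int.sign_eq_neg_one_of_neg h⟩)
  · subst h; simp
  · exact Or.inl ⟨h, Int.sign_eq_one_of_pos h⟩

lemma peerSign_mem (k : ι) (x : ι → ℤˣ) : -1 ≤ peerSign k x ∧ peerSign k x ≤ 1 := by
  unfold peerSign
  rcases intSign_cases (peerSum k x) with h | h | h <;> rw [h.2] <;> norm_num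

lemma abs_peerBias_le {m : ι → ℝ} (hm : ∀ i, |m i| ≤ 1 / 2) (k : ι) : |peerBias m k| ≤ 1 / 2 := by
  have h1 := signMean_mono hm fun x => (peerSign_mem k x).1
  have h2 := signMean_mono hm fun x => (peerSign_mem k x).2
  rw [signMean_const] at h1 h2
  rw [abs_le, peerBias]
  constructor <;> linarith

lemma peerBias_neg (m : ι → ℝ) (k : ι) : peerBias (-m) k = -peerBias m k := by
  unfold peerBias signMean
  rw [← sum_mul_left_sign (-1), ← neg_div, ← Finset.sum_neg_distrib]
  congr 1
  refine Finset.sum_congr rfl fun x _ => ?_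
  have h1 : signMass (-m) (-1 * x) = signMass m x :=
    Finset.prod_congr rfl fun i _ => by simp
  have h2 : peerSign k (-1 * x) = -peerSign k x := by
    have h3 : peerSum k (-1 * x) = -peerSum k x := by
      unfold peerSum
      rw [← Finset.sum_neg_distrib]
      exact Finset.sum_congr rfl fun i _ => by simp
    rw [peerSign, h3, Int.sign_neg, Int.cast_neg, peerSign]
  rw [h1, h2]; ring

lemma peerBias_update_self (m : ι → ℝ) (k : ι) (a : ℝ) :
    peerBias (Function.update m k a) k = peerBias m k := by
  unfold peerBias
  rw [signMean_update_of_indep m k a fun x => peerSign_flipAt k x]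

/-- If every coordinate is fair or deterministic and the deterministic peers of `k` do not have a
positive sum, then the majority of the peers does not lean to the positive side. -/
lemma peerBias_nonpos {m : ι → ℝ} {s : ι → ℤ} (hs : ∀ i, s i = -1 ∨ s i = 0 ∨ s i = 1)
    (hm : ∀ i, m i = s i / 2) {k : ι} (h : ∑ i ∈ Finset.univ.erase k, s i ≤ 0) :
    peerBias m k ≤ 0 := by
  have hm' : ∀ i, |m i| ≤ 1 / 2 := fun i => by
    rcases hs i with h | h | h <;> rw [hm, h] <;> norm_num [abs_le]
  set r : ι → ℤˣ := fun i => if s i = 0 then -1 else 1 with hr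
  have hmass : ∀ x, signMass m (r * x) = signMass m x := fun x =>
    Finset.prod_congr rfl fun i _ => by
      by_cases h0 : s i = 0 <;> simp [hr, h0, hm]
  -- Reversing the fair coordinates preserves the law, and on its support it maps a peer sum `a` to
  -- `2 ∑ s - a ≤ -a`. The two majority signs of such a pair therefore add up to at most zero.
  have key : ∑ x, signMass m x * (peerSign k x + peerSign k (r * x)) ≤ 0 := by
    refine Finset.sum_nonpos fun x _ => ?_
    by_cases hx : ∀ i, s i ≠ 0 → (x i : ℤ) = s i
    · refine mul_nonpos_of_nonneg_of_nonpos (signMass_nonneg hm' x) ?_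
      have hsum : peerSum k x + peerSum k (r * x) ≤ 0 := by
        have : peerSum k x + peerSum k (r * x) = 2 * ∑ i ∈ Finset.univ.erase k, s i := by
          unfold peerSum
          rw [← Finset.sum_add_distrib, Finset.mul_sum]
          refine Finset.sum_congr rfl fun i _ => ?_
          by_cases h0 : s i = 0
          · simp [hr, h0]
          · simp [hr, h0, hx i h0]; ring
        omega
      have : (peerSum k x).sign + (peerSum k (r * x)).sign ≤ 0 := by
        rcases intSign_cases (peerSum k x) with h | h | h <;>
        rcases intSign_cases (peerSum k (r * x)) with h' | h' | h' <;> omega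
      unfold peerSign
      exact_mod_cast this
    · push Not at hx
      obtain ⟨i, h0, hi⟩ := hx
      have : signMass m x = 0 := by
        refine Finset.prod_eq_zero (Finset.mem_univ i) ?_
        rw [hm]
        rcases hs i with h | h | h
        · rcases Int.units_eq_one_or (x i) with h' | h'
          · rw [h, h']; norm_num
          · exact absurd (by rw [h', h]; rfl) hi
        · exact absurd h h0
        · rcases Int.units_eq_one_or (x i) with h' | h'
          · exact absurd (by rw [h', h]; rfl) hi
          · rw [h, h']; norm_num
      rw [this, zero_mul]
  have h2 : ∑ x, signMass m x * (peerSign k x + peerSign k (r * x))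
      = 2 * signMean m (peerSign k) := by
    have := sum_mul_left_sign r fun x => signMass m x * peerSign k x
    simp only [hmass] at this
    simp only [mul_add, Finset.sum_add_distrib, this]
    unfold signMean
    ring
  unfold peerBias
  linarith

lemma peerBias_nonneg {m : ι → ℝ} {s : ι → ℤ} (hs : ∀ i, s i = -1 ∨ s i = 0 ∨ s i = 1)
    (hm : ∀ i, m i = s i / 2) {k : ι} (h : 0 ≤ ∑ i ∈ Finset.univ.erase k, s i) :
    0 ≤ peerBias m k := by
  have := peerBias_nonpos (m := -m) (s := -s) (k := k)
    (fun i => by have := hs i; simp only [Pi.neg_apply]; omega)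
    (fun i => by simp [hm]; ring) (by simpa using h)
  rw [peerBias_neg] at this
  linarith

/-- A fair peer halves the lean in the case of a deterministic lead of one. -/
lemma peerBias_le_quarter {m : ι → ℝ} {s : ι → ℤ} (hs : ∀ i, s i = -1 ∨ s i = 0 ∨ s i = 1)
    (hm : ∀ i, m i = s i / 2) {k l : ι} (hlk : l ≠ k) (hl : s l = 0)
    (h : ∑ i ∈ Finset.univ.erase k, s i ≤ 1) : peerBias m k ≤ 1 / 4 := by
  have hm' : ∀ i, |m i| ≤ 1 / 2 := fun i => by
    rcases hs i with h | h | h <;> rw [hm, h] <;> norm_num [abs_le]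
  have h1 : peerBias (Function.update m l (-(1 / 2))) k ≤ 0 := by
    refine peerBias_nonpos (s := Function.update s l (-1)) ?_ ?_ ?_
    · intro i
      by_cases hi : i = l
      · subst hi; simp
      · simpa [hi] using hs i
    · intro i
      by_cases hi : i = l
      · subst hi; norm_num
      · simpa [hi] using hm i
    · rw [Finset.sum_update_of_mem (by simp [hlk])]
      rw [← Finset.add_sum_erase _ _ (Finset.mem_erase.2 ⟨hlk, Finset.mem_univ l⟩), hl,
        Finset.erase_eq] at h
      omega
  have h2 : peerBias (Function.update m l (1 / 2)) k ≤ 1 / 2 := by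
    refine le_trans (le_abs_self _) (abs_peerBias_le (fun i => ?_) k)
    by_cases hi : i = l
    · subst hi; norm_num [abs_le]
    · simpa [hi] using hm' i
  -- The value at `m l = 0` is the midpoint of the values at `m l = ∓1/2`, which are at most `0` and
  -- `1/2`.
  have h3 := signMean_eq m l (peerSign k)
  rw [hm, hl] at h3
  unfold peerBias at *
  rw [signMean_update] at h1 h2
  norm_num at h3
  linarith

lemma neg_quarter_le_peerBias {m : ι → ℝ} {s : ι → ℤ} (hs : ∀ i, s i = -1 ∨ s i = 0 ∨ s i = 1)
    (hm : ∀ i, m i = s i / 2) {k l : ι} (hlk : l ≠ k) (hl : s l = 0)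
    (h : -1 ≤ ∑ i ∈ Finset.univ.erase k, s i) : -(1 / 4) ≤ peerBias m k := by
  have := peerBias_le_quarter (m := -m) (s := -s) (k := k)
    (fun i => by have := hs i; simp only [Pi.neg_apply]; omega)
    (fun i => by simp [hm]; ring) hlk (by simp [hl]) (by
      simp only [Pi.neg_apply, Finset.sum_neg_distrib]; omega)
  rw [peerBias_neg] at this
  linarith

/-- The total pseudo competence defect, with the part of `j` replaced by its lean. -/
noncomputable def defectSlack (m : ι → ℝ) (j : ι) : ℝ :=
  ∑ k, |m k| * (1 - 2 * peerBias m k) - |m j| + 2 * peerBias m j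

/-- Every voter is fair or deterministic here. If `g j < 0`, the deterministic peers of `j` have a
negative sum, so some peer is surely wrong; such peers usually have the majority of their own peers
on their side and then contribute at least `1/2`. Where that is not enough, a fair third voter
improves the estimate of `g j` from `-1/2` to `-1/4`. -/
lemma defectSlack_nonneg_of_vertex (hcard : 3 ≤ Fintype.card ι) {m : ι → ℝ} {s : ι → ℤ}
    (hs : ∀ i, s i = -1 ∨ s i = 0 ∨ s i = 1) (hm : ∀ i, m i = s i / 2) (j : ι) :
    0 ≤ defectSlack m j := by
  have hm' : ∀ i, |m i| ≤ 1 / 2 := fun i => by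
    rcases hs i with h | h | h <;> rw [hm, h] <;> norm_num [abs_le]
  have hg : ∀ i, -(1 / 2) ≤ peerBias m i ∧ peerBias m i ≤ 1 / 2 := fun i =>
    abs_le.1 (abs_peerBias_le hm' i)
  have hterm : ∀ i, 0 ≤ |m i| * (1 - 2 * peerBias m i) := fun i =>
    mul_nonneg (abs_nonneg _) (by have := (hg i).2; linarith)
  have habs : ∀ i, s i ≠ 0 → |m i| = 1 / 2 := fun i hi => by
    rcases hs i with h | h | h
    · rw [hm, h]; norm_num
    · exact absurd h hi
    · rw [hm, h]; norm_num
  unfold defectSlack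
  rw [← Finset.add_sum_erase _ _ (Finset.mem_univ j)]
  set S := ∑ k ∈ Finset.univ.erase j, |m k| * (1 - 2 * peerBias m k) with hS
  have hS0 : 0 ≤ S := Finset.sum_nonneg fun i _ => hterm i
  have hSk : ∀ k, k ≠ j → |m k| * (1 - 2 * peerBias m k) ≤ S := fun k hk =>
    Finset.single_le_sum (f := fun k => |m k| * (1 - 2 * peerBias m k)) (fun i _ => hterm i)
      (Finset.mem_erase.2 ⟨hk, Finset.mem_univ k⟩)
  by_cases hgj : 0 ≤ peerBias m j
  -- The terms of `j` add up to `2 g j (1 - |m j|)`.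
  · nlinarith [hm' j, abs_nonneg (m j)]
  have hDj : ∑ i ∈ Finset.univ.erase j, s i ≤ -1 := by
    by_contra hcon
    exact hgj (peerBias_nonneg hs hm (by omega))
  set D := ∑ i, s i with hD
  have hDk : ∀ k, ∑ i ∈ Finset.univ.erase k, s i = D - s k := fun k => by
    rw [hD, ← Finset.add_sum_erase _ _ (Finset.mem_univ k)]; ring
  rw [hDk] at hDj
  obtain ⟨k, hkj, hk⟩ : ∃ k, k ≠ j ∧ s k = -1 := by
    by_contra hcon
    push Not at hcon
    have : 0 ≤ ∑ i ∈ Finset.univ.erase j, s i := Finset.sum_nonneg fun i hi => by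
      have h1 := hs i
      have h2 := hcon i (Finset.ne_of_mem_erase hi)
      omega
    rw [hDk] at this
    omega
  -- A deterministic voter whose deterministic peers have no positive lead has `g i ≤ 0`, so its
  -- defect is at least `1/2`.
  have half_le : ∀ i, i ≠ j → s i ≠ 0 → D - s i ≤ 0 → 1 / 2 ≤ |m i| * (1 - 2 * peerBias m i) := by
    intro i _ h0 hi
    have := peerBias_nonpos hs hm (k := i) (by rw [hDk]; exact hi)
    rw [habs i h0]
    linarith
  obtain ⟨l, hlj, hlk⟩ : ∃ l, l ≠ j ∧ l ≠ k := by
    obtain ⟨l, hl⟩ : ∃ l, l ∉ ({j, k} : Finset ι) := by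
      by_contra hcon
      push Not at hcon
      have := Finset.card_le_card (fun x _ => hcon x : Finset.univ ⊆ ({j, k} : Finset ι))
      rw [Finset.card_univ] at this
      have := Finset.card_le_two (a := j) (b := k)
      omega
    simp only [Finset.mem_insert, Finset.mem_singleton, not_or] at hl
    exact ⟨l, hl.1, hl.2⟩
  -- The terms of `j` add up to `g j` if `|m j| = 1/2`, but to `2 g j` if `m j = 0`; the peers must
  -- supply `1/2` or `1` accordingly, unless the bound `-1/4` on `g j` is available.
  rcases hs j with hj | hj | hj
  · have h1 := half_le k hkj (by omega) (by omega)
    have h2 := hSk k hkj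
    rw [habs j (by omega)]
    linarith [(hg j).1]
  · have hj0 : m j = 0 := by rw [hm, hj]; norm_num
    have h1 := half_le k hkj (by omega) (by omega)
    rw [hj0]
    by_cases hex : ∃ i, i ≠ j ∧ i ≠ k ∧ s i ≠ 0
    · obtain ⟨i, hij, hik, hi0⟩ := hex
      have h2 := half_le i hij hi0 (by have := hs i; omega)
      have h3 : |m k| * (1 - 2 * peerBias m k) + |m i| * (1 - 2 * peerBias m i) ≤ S := by
        rw [← Finset.sum_pair (f := fun k => |m k| * (1 - 2 * peerBias m k)) hik.symm]
        refine Finset.sum_le_sum_of_subset_of_nonneg ?_ fun i _ _ => hterm i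
        intro a ha
        simp only [Finset.mem_insert, Finset.mem_singleton] at ha
        rcases ha with rfl | rfl <;> simp [hkj, hij]
      simp
      linarith [(hg j).1]
    · push Not at hex
      have hDv : D = -1 := by
        rw [hD, Finset.sum_eq_single k, hk]
        · intro b _ hb
          by_cases hbj : b = j
          · rw [hbj, hj]
          · exact hex b hbj hb
        · simp
      have h2 := neg_quarter_le_peerBias hs hm (k := j) hlj (hex l hlj hlk) (by rw [hDk]; omega)
      have h3 := hSk k hkj
      simp
      linarith
  · rw [habs j (by omega)]
    by_cases hex : ∃ i, i ≠ j ∧ s i = 1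
    · obtain ⟨i, hij, hi⟩ := hex
      have h1 := half_le i hij (by omega) (by omega)
      have h2 := hSk i hij
      linarith [(hg j).1]
    · push Not at hex
      by_cases hD2 : D - s j ≤ -2
      · have h1 := half_le k hkj (by omega) (by omega)
        have h2 := hSk k hkj
        linarith [(hg j).1]
      -- The peers of `j` now have deterministic sum exactly `-1` and none of them is surely right,
      -- so `k` is the only deterministic one. The fair voter `l` gives both `g j ≥ -1/4` and `g k ≤
      -- 1/4`, and the defect `1/4` of `k` just balances.
      · have hl0 : s l = 0 := by
          by_contra hl0
          have hle : ∑ i ∈ Finset.univ.erase j, s i ≤ ∑ i ∈ ({k, l} : Finset ι), s i := by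
            rw [← neg_le_neg_iff, ← Finset.sum_neg_distrib, ← Finset.sum_neg_distrib]
            refine Finset.sum_le_sum_of_subset_of_nonneg ?_ ?_
            · intro a ha
              simp only [Finset.mem_insert, Finset.mem_singleton] at ha
              rcases ha with rfl | rfl <;> simp [hkj, hlj]
            · intro i hi _
              have h1 := hs i
              have h2 := hex i (Finset.ne_of_mem_erase hi)
              omega
          rw [Finset.sum_pair hlk.symm, hDk, hk] at hle
          have h1 := hs l
          have h2 := hex l hlj
          omega
        have h1 := neg_quarter_le_peerBias hs hm (k := j) hlj hl0 (by rw [hDk]; omega)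
        have h2 := peerBias_le_quarter hs hm (k := k) hlk hl0 (by rw [hDk]; omega)
        have h3 := hSk k hkj
        rw [habs k (by omega)] at h3
        linarith

/-- Each `peerBias` is affine in `m i`, and that of `i` does not involve `m i`. Hence no product of
`m i` with itself or with `|m i|` occurs. -/
lemma defectSlack_update (m : ι → ℝ) (i j : ι) :
    ∃ α β γ : ℝ, ∀ a, defectSlack (Function.update m i a) j = α + β * a + γ * |a| := by
  have hg : ∀ k, ∃ u v : ℝ, ∀ a, peerBias (Function.update m i a) k = u + v * a := fun k =>
    ⟨(1 / 2) * (∑ x, restMass m i x * peerSign k x) / 2,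
      (∑ x, restMass m i x * (signVal (x i) * peerSign k x)) / 2, fun a => by
        rw [peerBias, signMean_update]; ring⟩
  choose u v huv using hg
  have hi : ∀ a, peerBias (Function.update m i a) i = peerBias m i := peerBias_update_self m i
  have hsum : ∀ a, ∑ k, |Function.update m i a k| * (1 - 2 * peerBias (Function.update m i a) k)
      = |a| * (1 - 2 * peerBias m i) + ((∑ k ∈ Finset.univ.erase i, |m k| * (1 - 2 * u k))
        + (∑ k ∈ Finset.univ.erase i, |m k| * (-2 * v k)) * a) := fun a => by
    rw [← Finset.add_sum_erase _ _ (Finset.mem_univ i), hi, Function.update_self,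
      Finset.sum_mul, ← Finset.sum_add_distrib]
    congr 1
    refine Finset.sum_congr rfl fun k hk => ?_
    rw [Function.update_of_ne (Finset.ne_of_mem_erase hk), huv]; ring
  unfold defectSlack
  by_cases hij : j = i
  · subst hij
    refine ⟨(∑ k ∈ Finset.univ.erase j, |m k| * (1 - 2 * u k)) + 2 * peerBias m j,
      ∑ k ∈ Finset.univ.erase j, |m k| * (-2 * v k), -2 * peerBias m j, fun a => ?_⟩
    rw [hsum, hi, Function.update_self]; ring
  · refine ⟨(∑ k ∈ Finset.univ.erase i, |m k| * (1 - 2 * u k)) - |m j| + 2 * u j,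
      (∑ k ∈ Finset.univ.erase i, |m k| * (-2 * v k)) + 2 * v j, 1 - 2 * peerBias m i, fun a => ?_⟩
    rw [hsum, huv, Function.update_of_ne hij]; ring

/-- With at least three voters, the total defect `∑ |m k| (1 - 2 g k)` of the pseudo competences
is at least `|m j| - 2 g j`. -/
theorem defectSlack_nonneg (hcard : 3 ≤ Fintype.card ι) {m : ι → ℝ} (hm : ∀ i, |m i| ≤ 1 / 2)
    (j : ι) : 0 ≤ defectSlack m j := by
  -- In each coordinate the slack is affine on `[-1/2, 0]` and on `[0, 1/2]`, so it is smallest at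
  -- one of `-1/2, 0, 1/2`. The set `S` contains the coordinates not yet moved to such a point.
  suffices h : ∀ (S : Finset ι) (m : ι → ℝ), (∀ i, |m i| ≤ 1 / 2) →
      (∀ i, i ∉ S → ∃ s : ℤ, (s = -1 ∨ s = 0 ∨ s = 1) ∧ m i = s / 2) → 0 ≤ defectSlack m j from
    h Finset.univ m hm fun i hi => absurd (Finset.mem_univ i) hi
  intro S
  induction S using Finset.induction_on with
  | empty =>
    intro m _ h
    choose s hs hms using fun i => h i (Finset.notMem_empty i)
    exact defectSlack_nonneg_of_vertex hcard hs hms j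
  | insert i S hiS ih =>
    intro m hm h
    obtain ⟨α, β, γ, hαβγ⟩ := defectSlack_update m i j
    have hv : ∀ s : ℤ, (s = -1 ∨ s = 0 ∨ s = 1) → 0 ≤ α + β * (s / 2 : ℝ) + γ * |(s / 2 : ℝ)| := by
      intro s hs
      rw [← hαβγ]
      refine ih _ (fun k => ?_) fun k hk => ?_
      · by_cases hki : k = i
        · subst hki
          rw [Function.update_self]
          rcases hs with rfl | rfl | rfl <;> norm_num [abs_le]
        · simpa [hki] using hm k
      · by_cases hki : k = i
        · subst hki
          exact ⟨s, hs, Function.update_self _ _ _⟩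
        · rw [Function.update_of_ne hki]
          exact h k (by simp [hki, hk])
    have h0 := hv 0 (by norm_num)
    have h1 := hv 1 (by norm_num)
    have h2 := hv (-1) (by norm_num)
    norm_num [abs_of_neg, abs_of_pos] at h0 h1 h2
    have h3 := hαβγ (m i)
    rw [Function.update_eq_self] at h3
    rw [h3]
    have h4 := hm i
    rcases le_total 0 (m i) with h5 | h5
    · rw [abs_of_nonneg h5] at h4 ⊢
      nlinarith
    · rw [abs_of_nonpos h5] at h4 ⊢
      nlinarith

end PeerMajority

/-! ### Error of a weighted vote whose weights are ideal off a set of voters. -/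

section WeightedError

/-- The error of the vote with score `r` for the true state, a tie counting one half. -/
noncomputable def errSign (r : ℝ) : ℝ := if 0 < r then 0 else if r < 0 then 1 else 1 / 2

lemma errSign_cases (r : ℝ) :
    (0 < r ∧ errSign r = 0) ∨ (r = 0 ∧ errSign r = 1 / 2) ∨ (r < 0 ∧ errSign r = 1) := by
  rcases lt_trichotomy r 0 with h | h | h
  · exact Or.inr (Or.inr ⟨h, by simp [errSign, h, h.not_gt]⟩)
  · exact Or.inr (Or.inl ⟨h, by simp [errSign, h]⟩)
  · exact Or.inl ⟨h, by simp [errSign, h]⟩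

lemma exp_add_exp_neg_le {a b : ℝ} (h : |a| ≤ |b|) :
    Real.exp a + Real.exp (-a) ≤ Real.exp b + Real.exp (-b) := by
  have := Real.cosh_le_cosh.2 h
  rw [Real.cosh_eq, Real.cosh_eq] at this
  linarith

/-- If both scores are negative, `|t| < |σ|` and the two hyperbolic cosines are compared. If only
one is, its exponential is at most one of `exp (±σ/2)`. -/
lemma exp_mul_errSign_le (t σ : ℝ) :
    Real.exp (t / 2) * errSign (t + σ) + Real.exp (-(t / 2)) * errSign (σ - t)
      ≤ Real.exp (σ / 2) + Real.exp (-(σ / 2)) := by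
  have p1 := Real.exp_pos (t / 2)
  have p2 := Real.exp_pos (-(t / 2))
  have p3 := Real.exp_pos (σ / 2)
  have p4 := Real.exp_pos (-(σ / 2))
  rcases errSign_cases (t + σ) with ⟨h, e⟩ | ⟨h, e⟩ | ⟨h, e⟩ <;>
    rcases errSign_cases (σ - t) with ⟨h', e'⟩ | ⟨h', e'⟩ | ⟨h', e'⟩ <;> rw [e, e']
  · linarith
  · have : Real.exp (-(t / 2)) ≤ Real.exp (σ / 2) := Real.exp_le_exp.2 (by linarith)
    linarith
  · have : Real.exp (-(t / 2)) ≤ Real.exp (σ / 2) := Real.exp_le_exp.2 (by linarith)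
    linarith
  · have : Real.exp (t / 2) = Real.exp (-(σ / 2)) := by congr 1; linarith
    linarith
  · have : Real.exp (t / 2) = Real.exp (-(σ / 2)) := by congr 1; linarith
    have : Real.exp (-(t / 2)) = Real.exp (σ / 2) := by congr 1; linarith
    linarith
  · have : Real.exp (t / 2) = Real.exp (-(σ / 2)) := by congr 1; linarith
    have : Real.exp (-(t / 2)) = Real.exp (σ / 2) := by congr 1; linarith
    linarith
  · have : Real.exp (t / 2) ≤ Real.exp (-(σ / 2)) := Real.exp_le_exp.2 (by linarith)
    linarith
  · have : Real.exp (t / 2) = Real.exp (σ / 2) := by congr 1; linarith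
    have : Real.exp (-(t / 2)) = Real.exp (-(σ / 2)) := by congr 1; linarith
    linarith
  · have := exp_add_exp_neg_le (a := t / 2) (b := σ / 2) (by
      rw [abs_le, abs_of_neg (by linarith : σ / 2 < 0)]; constructor <;> linarith)
    linarith

/-- Adding the cases `σ` and `-σ` costs no more than one of them in `exp_mul_errSign_le`: for `|t| <
|σ|` each of `exp (±t/2)` occurs once, and for `|t| > |σ|` only the smaller one occurs, twice. -/
lemma exp_mul_errSign_add_le (t σ : ℝ) :
    (Real.exp (t / 2) * errSign (t + σ) + Real.exp (-(t / 2)) * errSign (σ - t))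
      + (Real.exp (t / 2) * errSign (t - σ) + Real.exp (-(t / 2)) * errSign (-σ - t))
      ≤ Real.exp (σ / 2) + Real.exp (-(σ / 2)) := by
  have p1 := Real.exp_pos (t / 2)
  have p2 := Real.exp_pos (-(t / 2))
  have p3 := Real.exp_pos (σ / 2)
  have p4 := Real.exp_pos (-(σ / 2))
  have n1 : errSign (t - σ) = 1 - errSign (σ - t) := by
    rcases errSign_cases (t - σ) with ⟨h, e⟩ | ⟨h, e⟩ | ⟨h, e⟩ <;>
    rcases errSign_cases (σ - t) with ⟨h', e'⟩ | ⟨h', e'⟩ | ⟨h', e'⟩ <;> rw [e, e'] <;> linarith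
  have n2 : errSign (-σ - t) = 1 - errSign (t + σ) := by
    rcases errSign_cases (-σ - t) with ⟨h, e⟩ | ⟨h, e⟩ | ⟨h, e⟩ <;>
    rcases errSign_cases (t + σ) with ⟨h', e'⟩ | ⟨h', e'⟩ | ⟨h', e'⟩ <;> rw [e, e'] <;> linarith
  rw [n1, n2]
  rcases errSign_cases (t + σ) with ⟨h, e⟩ | ⟨h, e⟩ | ⟨h, e⟩ <;>
    rcases errSign_cases (σ - t) with ⟨h', e'⟩ | ⟨h', e'⟩ | ⟨h', e'⟩ <;> rw [e, e']
  · have := exp_add_exp_neg_le (a := t / 2) (b := σ / 2) (by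
      rw [abs_le, abs_of_pos (by linarith : 0 < σ / 2)]; constructor <;> linarith)
    linarith
  · have : Real.exp (t / 2) = Real.exp (σ / 2) := by congr 1; linarith
    have : Real.exp (-(t / 2)) = Real.exp (-(σ / 2)) := by congr 1; linarith
    have : Real.exp (-(t / 2)) ≤ Real.exp (t / 2) := Real.exp_le_exp.2 (by linarith)
    linarith
  · have : Real.exp (-(t / 2)) ≤ Real.exp (σ / 2) := Real.exp_le_exp.2 (by linarith)
    have : Real.exp (-(t / 2)) ≤ Real.exp (-(σ / 2)) := Real.exp_le_exp.2 (by linarith)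
    linarith
  · have : Real.exp (t / 2) = Real.exp (-(σ / 2)) := by congr 1; linarith
    have : Real.exp (-(t / 2)) = Real.exp (σ / 2) := by congr 1; linarith
    have : Real.exp (t / 2) ≤ Real.exp (-(t / 2)) := Real.exp_le_exp.2 (by linarith)
    linarith
  · have : Real.exp (t / 2) = Real.exp (-(σ / 2)) := by congr 1; linarith
    have : Real.exp (-(t / 2)) = Real.exp (σ / 2) := by congr 1; linarith
    linarith
  · have : Real.exp (t / 2) = Real.exp (-(σ / 2)) := by congr 1; linarith
    have : Real.exp (-(t / 2)) = Real.exp (σ / 2) := by congr 1; linarith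
    have : Real.exp (-(t / 2)) ≤ Real.exp (t / 2) := Real.exp_le_exp.2 (by linarith)
    linarith
  · have : Real.exp (t / 2) ≤ Real.exp (-(σ / 2)) := Real.exp_le_exp.2 (by linarith)
    have : Real.exp (t / 2) ≤ Real.exp (σ / 2) := Real.exp_le_exp.2 (by linarith)
    linarith
  · have : Real.exp (t / 2) = Real.exp (σ / 2) := by congr 1; linarith
    have : Real.exp (-(t / 2)) = Real.exp (-(σ / 2)) := by congr 1; linarith
    have : Real.exp (t / 2) ≤ Real.exp (-(t / 2)) := Real.exp_le_exp.2 (by linarith)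
    linarith
  · have := exp_add_exp_neg_le (a := t / 2) (b := σ / 2) (by
      rw [abs_le, abs_of_neg (by linarith : σ / 2 < 0)]; constructor <;> linarith)
    linarith

/-- The logarithm of the odds of a competence `1 / 2 + e`. -/
noncomputable def logit (e : ℝ) : ℝ := Real.log ((1 / 2 + e) / (1 / 2 - e))

lemma sqrt_one_sub_pos {e : ℝ} (he : |e| < 1 / 2) : 0 < √(1 - 4 * e ^ 2) := by
  have := abs_lt.1 he
  exact Real.sqrt_pos.2 (by nlinarith)

lemma exp_half_logit {e : ℝ} (he : |e| < 1 / 2) :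
    Real.exp (logit e / 2) = (1 + 2 * e) / √(1 - 4 * e ^ 2) := by
  have h := abs_lt.1 he
  have h1 : 0 < 1 / 2 + e := by linarith
  have h2 : 0 < 1 / 2 - e := by linarith
  have h3 : 0 ≤ 1 + 2 * e := by linarith
  have h4 := sqrt_one_sub_pos he
  have h5 : (0 : ℝ) < 1 - 4 * e ^ 2 := by nlinarith
  rw [Real.exp_half, logit, Real.exp_log (div_pos h1 h2), eq_div_iff h4.ne',
    ← Real.sqrt_mul (div_pos h1 h2).le]
  rw [show (1 / 2 + e) / (1 / 2 - e) * (1 - 4 * e ^ 2) = (1 + 2 * e) ^ 2 by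
    rw [div_mul_eq_mul_div, div_eq_iff h2.ne']; ring]
  exact Real.sqrt_sq h3

lemma logit_neg (e : ℝ) : logit (-e) = -logit e := by
  unfold logit
  rw [← Real.log_inv, inv_div]
  congr 2
  ring

lemma exp_neg_half_logit {e : ℝ} (he : |e| < 1 / 2) :
    Real.exp (-(logit e / 2)) = (1 - 2 * e) / √(1 - 4 * e ^ 2) := by
  have := exp_half_logit (e := -e) (by rwa [abs_neg])
  rw [logit_neg] at this
  rw [← neg_div, this]
  congr 2 <;> ring

/-- A voter with its ideal weight has a mass that is an exponential tilt by half its signed weight.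
This couples the law off `W` to the score of the vote. -/
lemma half_add_eq_exp {e : ℝ} (he : |e| < 1 / 2) (u : ℤˣ) :
    1 / 2 + e * signVal u = √(1 - 4 * e ^ 2) / 2 * Real.exp (logit e * signVal u / 2) := by
  have h := (sqrt_one_sub_pos he).ne'
  have h1 := exp_half_logit he
  have h2 := exp_neg_half_logit he
  generalize √(1 - 4 * e ^ 2) = r at h h1 h2
  rcases signVal_eq u with hu | hu <;> rw [hu]
  · rw [mul_one, mul_one, h1]; field_simp
  · rw [show logit e * -1 / 2 = -(logit e / 2) by ring, h2]; field_simp; ring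

lemma sum_exp_half_logit {e : ℝ} (he : |e| < 1 / 2) (a : ℝ) :
    (1 / 2 + a) * Real.exp (logit e / 2) + (1 / 2 - a) * Real.exp (-(logit e / 2))
      = (1 + 4 * a * e) * (√(1 - 4 * e ^ 2))⁻¹ := by
  rw [exp_half_logit he, exp_neg_half_logit he]; ring

variable {ι : Type*} [Fintype ι] [DecidableEq ι]

lemma sum_prod_mem_sign (W : Finset ι) (f : ι → ℤˣ → ℝ) :
    ∑ x : ι → ℤˣ, ∏ i ∈ W, f i (x i)
      = (∏ i ∈ W, (f i 1 + f i (-1))) * 2 ^ Wᶜ.card := by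
  have h1 : ∀ x : ι → ℤˣ, ∏ i ∈ W, f i (x i) = ∏ i, (if i ∈ W then f i else fun _ => 1) (x i) := by
    intro x
    simp only [ite_apply]
    rw [Finset.prod_ite_mem, Finset.univ_inter]
  simp_rw [h1]
  rw [sum_prod_sign fun i => if i ∈ W then f i else fun _ => 1, ← Finset.prod_mul_prod_compl W]
  congr 1
  · exact Finset.prod_congr rfl fun i hi => by simp only [if_pos hi]
  · rw [← Finset.prod_const]
    exact Finset.prod_congr rfl fun i hi => by
      simp only [if_neg (Finset.mem_compl.1 hi)]; norm_num

/-- An error bound for the weighted vote with weights `logit (e i)` that are ideal for the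
coordinates outside `W`, the law of the coordinates in `W` being arbitrary. -/
theorem signMean_errSign_le (W : Finset ι) {m e : ι → ℝ} (hm : ∀ i ∈ W, |m i| ≤ 1 / 2)
    (he : ∀ i, |e i| < 1 / 2) (hme : ∀ i, i ∉ W → m i = e i) :
    signMean m (fun x => errSign (∑ i, logit (e i) * signVal (x i))) ≤
      1 / 2 * (∏ i ∈ Wᶜ, √(1 - 4 * e i ^ 2)) * (∏ i ∈ W, (√(1 - 4 * e i ^ 2))⁻¹) *
        (∏ i ∈ W, (1 + 4 * m i * e i) + ∏ i ∈ W, (1 - 4 * m i * e i)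
          - ∏ i ∈ W, (1 - 2 * |m i|)) := by
  set t : (ι → ℤˣ) → ℝ := fun x => ∑ i ∈ Wᶜ, logit (e i) * signVal (x i) with ht
  set σ : (ι → ℤˣ) → ℝ := fun x => ∑ i ∈ W, logit (e i) * signVal (x i) with hσ
  set μ : (ι → ℤˣ) → ℝ := fun x => ∏ i ∈ W, (1 / 2 + m i * signVal (x i)) with hμ
  set c : ℝ := ∏ i ∈ Wᶜ, (√(1 - 4 * e i ^ 2) / 2) with hc
  -- A uniform lower bound for the mass `μ` on `W`: the part `κ` of `μ` is symmetric under reversal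
  -- of `W`, and there the error estimate improves by a factor of two.
  set κ : ℝ := ∏ i ∈ W, (1 / 2 - |m i|) with hκ
  have hc0 : 0 ≤ c := Finset.prod_nonneg fun i _ => by positivity
  have hκ0 : 0 ≤ κ := Finset.prod_nonneg fun i hi => by have := hm i hi; linarith
  have hκμ : ∀ x, κ ≤ μ x := fun x => Finset.prod_le_prod
    (fun i hi => by have := hm i hi; linarith) fun i _ => by
      have h1 := neg_abs_le (m i)
      have h2 := le_abs_self (m i)
      rcases signVal_eq (x i) with h | h <;> rw [h] <;> linarith
  have hmass : ∀ x, signMass m x = c * (Real.exp (t x / 2) * μ x) := by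
    intro x
    rw [signMass, ← Finset.prod_mul_prod_compl W, mul_comm]
    rw [Finset.prod_congr rfl fun i hi => by
      rw [hme i (Finset.mem_compl.1 hi), half_add_eq_exp (he i)]]
    rw [Finset.prod_mul_distrib, ← Real.exp_sum, ← Finset.sum_div]
    ring
  have hsplit : ∀ x : ι → ℤˣ, ∑ i, logit (e i) * signVal (x i) = t x + σ x := fun x => by
    rw [← Finset.sum_add_sum_compl W, add_comm]
  -- Multiplication by `a` reverses the votes off `W`, multiplication by `b` those in `W`.
  set a : ι → ℤˣ := fun i => if i ∈ W then 1 else -1 with ha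
  set b : ι → ℤˣ := fun i => if i ∈ W then -1 else 1 with hb
  have hta : ∀ x, t (a * x) = -t x := fun x => by
    rw [ht, ← Finset.sum_neg_distrib]
    exact Finset.sum_congr rfl fun i hi => by simp [ha, Finset.mem_compl.1 hi]
  have hσa : ∀ x, σ (a * x) = σ x := fun x =>
    Finset.sum_congr rfl fun i hi => by simp [ha, hi]
  have hμa : ∀ x, μ (a * x) = μ x := fun x =>
    Finset.prod_congr rfl fun i hi => by simp [ha, hi]
  have htb : ∀ x, t (b * x) = t x := fun x =>
    Finset.sum_congr rfl fun i hi => by simp [hb, Finset.mem_compl.1 hi]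
  have hσb : ∀ x, σ (b * x) = -σ x := fun x => by
    rw [hσ, ← Finset.sum_neg_distrib]
    exact Finset.sum_congr rfl fun i hi => by simp [hb, hi]
  set Θ : ℝ → ℝ → ℝ := fun t σ =>
    Real.exp (t / 2) * errSign (t + σ) + Real.exp (-(t / 2)) * errSign (σ - t) with hΘ
  have h1 : signMean m (fun x => errSign (∑ i, logit (e i) * signVal (x i)))
      = c / 2 * ∑ x, μ x * Θ (t x) (σ x) := by
    have h2 : signMean m (fun x => errSign (∑ i, logit (e i) * signVal (x i)))
        = c * ∑ x, Real.exp (t x / 2) * μ x * errSign (t x + σ x) := by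
      rw [signMean, Finset.mul_sum]
      refine Finset.sum_congr rfl fun x _ => ?_
      rw [hmass, hsplit]; ring
    have h3 := sum_mul_left_sign a fun x => Real.exp (t x / 2) * μ x * errSign (t x + σ x)
    simp only [hta, hσa, hμa] at h3
    have h4 : ∑ x, μ x * Θ (t x) (σ x) = ∑ x, Real.exp (t x / 2) * μ x * errSign (t x + σ x)
        + ∑ x, Real.exp (-t x / 2) * μ x * errSign (-t x + σ x) := by
      rw [← Finset.sum_add_distrib]
      refine Finset.sum_congr rfl fun x _ => ?_
      simp only [hΘ]
      rw [neg_div, show -t x + σ x = σ x - t x by ring]; ring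
    rw [h2, h4, h3]; ring
  set E : (ι → ℤˣ) → ℝ := fun x => Real.exp (σ x / 2) + Real.exp (-(σ x / 2)) with hE
  -- The part `μ - κ` uses the bound for a single `σ`, the part `κ` the one for the pair `σ, -σ`.
  have h2 : ∑ x, μ x * Θ (t x) (σ x) ≤ ∑ x, (μ x - κ / 2) * E x := by
    have h3 : ∑ x, (μ x - κ) * Θ (t x) (σ x) ≤ ∑ x, (μ x - κ) * E x :=
      Finset.sum_le_sum fun x _ => mul_le_mul_of_nonneg_left (exp_mul_errSign_le _ _)
        (sub_nonneg.2 (hκμ x))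
    have h4 : ∑ x, Θ (t x) (σ x) ≤ 1 / 2 * ∑ x, E x := by
      have h5 := sum_mul_left_sign b fun x => Θ (t x) (σ x)
      simp only [htb, hσb] at h5
      have h6 : ∑ x, (Θ (t x) (σ x) + Θ (t x) (-σ x)) ≤ ∑ x, E x :=
        Finset.sum_le_sum fun x _ => exp_mul_errSign_add_le _ _
      rw [Finset.sum_add_distrib, h5] at h6
      linarith
    have h7 : ∑ x, μ x * Θ (t x) (σ x)
        = ∑ x, (μ x - κ) * Θ (t x) (σ x) + κ * ∑ x, Θ (t x) (σ x) := by
      rw [Finset.mul_sum, ← Finset.sum_add_distrib]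
      exact Finset.sum_congr rfl fun x _ => by ring
    have h8 : ∑ x, (μ x - κ / 2) * E x = ∑ x, (μ x - κ) * E x + κ * (1 / 2 * ∑ x, E x) := by
      rw [Finset.mul_sum, Finset.mul_sum, ← Finset.sum_add_distrib]
      exact Finset.sum_congr rfl fun x _ => by ring
    have := mul_le_mul_of_nonneg_left h4 hκ0
    linarith
  have hexp : ∀ v : ℝ, ∀ x, Real.exp (v * σ x / 2)
      = ∏ i ∈ W, Real.exp (v * (logit (e i) * signVal (x i)) / 2) := fun v x => by
    rw [← Real.exp_sum, ← Finset.sum_div, ← Finset.mul_sum]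
  have hexp1 : ∀ x, Real.exp (σ x / 2) = ∏ i ∈ W, Real.exp (logit (e i) * signVal (x i) / 2) :=
    fun x => by simpa using hexp 1 x
  have hexp2 : ∀ x, Real.exp (-(σ x / 2))
      = ∏ i ∈ W, Real.exp (-(logit (e i) * signVal (x i) / 2)) :=
    fun x => by simpa [neg_div] using hexp (-1) x
  have s1 : ∑ x, μ x * Real.exp (σ x / 2)
      = (∏ i ∈ W, (1 + 4 * m i * e i) * (√(1 - 4 * e i ^ 2))⁻¹) * 2 ^ Wᶜ.card := by
    simp_rw [hexp1, hμ, ← Finset.prod_mul_distrib]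
    rw [sum_prod_mem_sign W fun i u =>
      (1 / 2 + m i * signVal u) * Real.exp (logit (e i) * signVal u / 2)]
    congr 1
    refine Finset.prod_congr rfl fun i _ => ?_
    rw [← sum_exp_half_logit (he i)]
    simp [neg_div, sub_eq_add_neg]
  have s2 : ∑ x, μ x * Real.exp (-(σ x / 2))
      = (∏ i ∈ W, (1 - 4 * m i * e i) * (√(1 - 4 * e i ^ 2))⁻¹) * 2 ^ Wᶜ.card := by
    simp_rw [hexp2, hμ, ← Finset.prod_mul_distrib]
    rw [sum_prod_mem_sign W fun i u =>
      (1 / 2 + m i * signVal u) * Real.exp (-(logit (e i) * signVal u / 2))]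
    congr 1
    refine Finset.prod_congr rfl fun i _ => ?_
    rw [show 1 - 4 * m i * e i = 1 + 4 * (-m i) * e i by ring, ← sum_exp_half_logit (he i)]
    simp [neg_div, sub_eq_add_neg]; ring
  have s3 : ∑ x, Real.exp (σ x / 2)
      = (∏ i ∈ W, 2 * (√(1 - 4 * e i ^ 2))⁻¹) * 2 ^ Wᶜ.card := by
    simp_rw [hexp1]
    rw [sum_prod_mem_sign W fun i u => Real.exp (logit (e i) * signVal u / 2)]
    congr 1
    refine Finset.prod_congr rfl fun i _ => ?_
    have := sum_exp_half_logit (he i) 0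
    simp only [mul_zero, zero_mul, add_zero, sub_zero, one_mul] at this
    rw [← this]
    simp [neg_div]; ring
  have s4 : ∑ x, Real.exp (-(σ x / 2))
      = (∏ i ∈ W, 2 * (√(1 - 4 * e i ^ 2))⁻¹) * 2 ^ Wᶜ.card := by
    rw [← s3]
    have := sum_mul_left_sign b fun x => Real.exp (σ x / 2)
    simp only [hσb] at this
    rw [← this]
    simp [neg_div]
  have h3 : ∑ x, (μ x - κ / 2) * E x = ∑ x, μ x * Real.exp (σ x / 2)
      + ∑ x, μ x * Real.exp (-(σ x / 2))
      - κ / 2 * (∑ x, Real.exp (σ x / 2) + ∑ x, Real.exp (-(σ x / 2))) := by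
    rw [← Finset.sum_add_distrib, ← Finset.sum_add_distrib, Finset.mul_sum,
      ← Finset.sum_sub_distrib]
    exact Finset.sum_congr rfl fun x _ => by simp only [hE]; ring
  -- The remaining integrands ignore the votes off `W`; the power of two from summing over these
  -- votes cancels the halves in `c`.
  have h4 : c * 2 ^ Wᶜ.card = ∏ i ∈ Wᶜ, √(1 - 4 * e i ^ 2) := by
    rw [hc, ← Finset.prod_const, ← Finset.prod_mul_distrib]
    exact Finset.prod_congr rfl fun i _ => by ring
  have h5 : κ * ∏ i ∈ W, 2 * (√(1 - 4 * e i ^ 2))⁻¹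
      = (∏ i ∈ W, (1 - 2 * |m i|)) * ∏ i ∈ W, (√(1 - 4 * e i ^ 2))⁻¹ := by
    rw [hκ, ← Finset.prod_mul_distrib, ← Finset.prod_mul_distrib]
    exact Finset.prod_congr rfl fun i _ => by ring
  rw [h1]
  refine (mul_le_mul_of_nonneg_left h2 (by positivity)).trans (le_of_eq ?_)
  rw [h3, s1, s2, s3, s4, Finset.prod_mul_distrib, Finset.prod_mul_distrib (s := W)
    (f := fun i => 1 - 4 * m i * e i), ← h4]
  linear_combination (-(c * 2 ^ Wᶜ.card) / 2) * h5

end WeightedError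

/-! ### Real inequalities: potential, correction factor, hyperbolic functions. -/

section RealBounds

/-- The right side is `sinh (log r)`. -/
lemma log_le_half_sub_inv {r : ℝ} (hr : 1 ≤ r) : Real.log r ≤ (r - r⁻¹) / 2 := by
  rw [← Real.sinh_log (by linarith)]
  exact Real.self_le_sinh_iff.2 (Real.log_nonneg hr)

lemma logit_eq {e : ℝ} (he : |e| < 1 / 2) :
    logit e = Real.log (1 + 2 * e) - Real.log (1 - 2 * e) := by
  have h := abs_lt.1 he
  rw [logit, ← Real.log_div (by linarith) (by linarith),
    show (1 / 2 + e) / (1 / 2 - e) = (1 + 2 * e) / (1 - 2 * e) by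
      rw [div_eq_div_iff (by linarith) (by linarith)]; ring]

/-- The left side vanishes at zero and decreases: its derivative is `log r - (r - r⁻¹) / 2` for `r =
(1 + z) / (1 - z)`. -/
lemma two_add_mul_log_le {z : ℝ} (h0 : 0 ≤ z) (h1 : z < 1) :
    (2 + z) * Real.log (1 + z) + (2 - z) * Real.log (1 - z) ≤ 0 := by
  have hd : ∀ x ∈ Set.Ico (0 : ℝ) 1, HasDerivAt
      (fun z => (2 + z) * Real.log (1 + z) + (2 - z) * Real.log (1 - z))
      ((1 * Real.log (1 + x) + (2 + x) * (1 / (1 + x)))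
        + (-1 * Real.log (1 - x) + (2 - x) * (-1 / (1 - x)))) x := by
    intro x hx
    have h3 : HasDerivAt (fun z : ℝ => 2 + z) 1 x := (hasDerivAt_id x).const_add 2
    have h4 : HasDerivAt (fun z : ℝ => 1 + z) 1 x := (hasDerivAt_id x).const_add 1
    have h5 : HasDerivAt (fun z : ℝ => 2 - z) (-1) x := (hasDerivAt_id x).const_sub 2
    have h6 : HasDerivAt (fun z : ℝ => 1 - z) (-1) x := (hasDerivAt_id x).const_sub 1
    exact (h3.mul (h4.log (by linarith [hx.1]))).add (h5.mul (h6.log (by linarith [hx.2])))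
  have hanti : AntitoneOn
      (fun z => (2 + z) * Real.log (1 + z) + (2 - z) * Real.log (1 - z)) (Set.Ico (0 : ℝ) 1) := by
    refine antitoneOn_of_deriv_nonpos (convex_Ico 0 1)
      (fun x hx => (hd x hx).continuousAt.continuousWithinAt) ?_ ?_
    · intro x hx
      exact (hd x (interior_subset hx)).differentiableAt.differentiableWithinAt
    · intro x hx
      have hx' := interior_subset hx
      rw [(hd x hx').deriv]
      have a1 : 0 < 1 + x := by linarith [hx'.1]
      have a2 : 0 < 1 - x := by linarith [hx'.2]
      have := log_le_half_sub_inv (r := (1 + x) / (1 - x)) (by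
        rw [le_div_iff₀ a2]; linarith [hx'.1])
      rw [Real.log_div a1.ne' a2.ne', inv_div] at this
      have h7 : ((1 + x) / (1 - x) - (1 - x) / (1 + x)) / 2
          = -((2 + x) * (1 / (1 + x)) + (2 - x) * (-1 / (1 - x))) := by
        field_simp; ring
      linarith
  have := hanti (Set.mem_Ico.2 ⟨le_rfl, one_pos⟩) (Set.mem_Ico.2 ⟨h0, h1⟩) h0
  simpa using this

lemma mul_logit_abs (e : ℝ) : |e| * logit |e| = e * logit e := by
  rcases abs_choice e with h | h <;> rw [h]
  rw [logit_neg]; ring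

/-- The ideal error factor of a voter is at most the exponential of minus half its potential. -/
lemma sqrt_le_exp_potential {e : ℝ} (he : |e| < 1 / 2) :
    √(1 - 4 * e ^ 2) ≤ Real.exp (-(e * logit e) / 2) := by
  rw [← mul_logit_abs, ← sq_abs]
  have h0 := abs_nonneg e
  have he' : |(|e|)| < 1 / 2 := by rwa [abs_abs]
  generalize |e| = a at *
  have he2 : a < 1 / 2 := by rwa [abs_of_nonneg h0] at he'
  have h1 : (0 : ℝ) < 1 + 2 * a := by linarith
  have h2 : (0 : ℝ) < 1 - 2 * a := by linarith
  rw [show 1 - 4 * a ^ 2 = (1 + 2 * a) * (1 - 2 * a) by ring, ← Real.exp_log (mul_pos h1 h2),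
    ← Real.exp_half, Real.exp_le_exp, Real.log_mul h1.ne' h2.ne', logit_eq he']
  -- After taking logarithms the claim is a quarter of this inequality.
  have := two_add_mul_log_le (z := 2 * a) (by linarith) (by linarith)
  nlinarith

/-- The logarithm of `exp (φ / 2) / √(1 - 4 e ^ 2)` for the potential `φ` of `e = z / 2`. -/
noncomputable def logCorrection (z : ℝ) : ℝ :=
  1 / 4 * ((1 + z) * Real.log (1 + z) + (1 - z) * Real.log (1 - z))
    - 3 / 4 * (Real.log (1 + z) + Real.log (1 - z))

lemma convexOn_logCorrection : ConvexOn ℝ (Set.Ioo (-1) 1) logCorrection := by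
  have e1 : ConvexOn ℝ (Set.Ioo (-1 : ℝ) 1) fun z => (1 + z) * Real.log (1 + z) := by
    refine ⟨convex_Ioo _ _, fun x hx y hy a b ha hb hab => ?_⟩
    have := Real.convexOn_mul_log.2 (x := 1 + x) (by simp; linarith [hx.1]) (y := 1 + y)
      (by simp; linarith [hy.1]) ha hb hab
    simp only [smul_eq_mul] at this ⊢
    rw [show 1 + (a * x + b * y) = a * (1 + x) + b * (1 + y) by linear_combination -hab]
    exact this
  have e2 : ConvexOn ℝ (Set.Ioo (-1 : ℝ) 1) fun z => (1 - z) * Real.log (1 - z) := by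
    refine ⟨convex_Ioo _ _, fun x hx y hy a b ha hb hab => ?_⟩
    have := Real.convexOn_mul_log.2 (x := 1 - x) (by simp; linarith [hx.2]) (y := 1 - y)
      (by simp; linarith [hy.2]) ha hb hab
    simp only [smul_eq_mul] at this ⊢
    rw [show 1 - (a * x + b * y) = a * (1 - x) + b * (1 - y) by linear_combination -hab]
    exact this
  have e3 : ConcaveOn ℝ (Set.Ioo (-1 : ℝ) 1) fun z => Real.log (1 + z) := by
    refine ⟨convex_Ioo _ _, fun x hx y hy a b ha hb hab => ?_⟩
    have := strictConcaveOn_log_Ioi.concaveOn.2 (x := 1 + x) (by simp; linarith [hx.1])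
      (y := 1 + y) (by simp; linarith [hy.1]) ha hb hab
    simp only [smul_eq_mul] at this ⊢
    rw [show 1 + (a * x + b * y) = a * (1 + x) + b * (1 + y) by linear_combination -hab]
    exact this
  have e4 : ConcaveOn ℝ (Set.Ioo (-1 : ℝ) 1) fun z => Real.log (1 - z) := by
    refine ⟨convex_Ioo _ _, fun x hx y hy a b ha hb hab => ?_⟩
    have := strictConcaveOn_log_Ioi.concaveOn.2 (x := 1 - x) (by simp; linarith [hx.2])
      (y := 1 - y) (by simp; linarith [hy.2]) ha hb hab
    simp only [smul_eq_mul] at this ⊢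
    rw [show 1 - (a * x + b * y) = a * (1 - x) + b * (1 - y) by linear_combination -hab]
    exact this
  exact ((e1.add e2).smul (by norm_num : (0 : ℝ) ≤ 1 / 4)).sub
    ((e3.add e4).smul (by norm_num : (0 : ℝ) ≤ 3 / 4))

/-- Multiplied by 32 the claim reads `2 ^ 32 / 3 ^ 12 ≤ exp 9`. -/
lemma logCorrection_half_le : logCorrection (1 / 2) ≤ 9 / 32 := by
  have h1 : logCorrection (1 / 2) = Real.log 2 - 3 / 8 * Real.log 3 := by
    unfold logCorrection
    rw [show (1 : ℝ) + 1 / 2 = 3 / 2 by norm_num, show (1 : ℝ) - 1 / 2 = 1 / 2 by norm_num,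
      Real.log_div (by norm_num) (by norm_num), Real.log_div (by norm_num) (by norm_num),
      Real.log_one]
    ring
  have h2 : 32 * Real.log 2 - 12 * Real.log 3 ≤ 9 := by
    have h3 : (32 : ℝ) * Real.log 2 - 12 * Real.log 3 = Real.log (2 ^ 32 / 3 ^ 12) := by
      rw [Real.log_div (by positivity) (by positivity), Real.log_pow, Real.log_pow]; norm_num
    rw [h3, Real.log_le_iff_le_exp (by positivity), show (9 : ℝ) = (9 : ℕ) * 1 by norm_num,
      Real.exp_nat_mul]
    calc (2 : ℝ) ^ 32 / 3 ^ 12 ≤ 2.7182818283 ^ 9 := by norm_num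
      _ ≤ Real.exp 1 ^ 9 := by gcongr; exact Real.exp_one_gt_d9.le
  rw [h1]; linarith

lemma logCorrection_five_ninth_le : logCorrection (5 / 9) ≤ 13 / 32 := by
  have h1 : Real.log (14 / 9) ≤ 0.46 := by
    rw [Real.log_le_iff_le_exp (by norm_num)]
    refine le_trans ?_ (Real.quadratic_le_exp_of_nonneg (by norm_num))
    norm_num
  have h2 : Real.log (4 / 9) ≤ -0.8 := by
    rw [Real.log_le_iff_le_exp (by norm_num), Real.exp_neg, le_inv_comm₀ (by norm_num)
      (Real.exp_pos _)]
    have h3 : Real.exp 0.8 ^ 5 ≤ (4 / 9 : ℝ)⁻¹ ^ 5 := by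
      rw [← Real.exp_nat_mul, show ((5 : ℕ) : ℝ) * 0.8 = (4 : ℕ) * 1 by norm_num,
        Real.exp_nat_mul]
      calc Real.exp 1 ^ 4 ≤ 2.7182818286 ^ 4 := by gcongr; exact Real.exp_one_lt_d9.le
        _ ≤ _ := by norm_num
    exact (pow_le_pow_iff_left₀ (Real.exp_pos _).le (by norm_num) (by norm_num)).1 h3
  have h3 : -Real.log (14 / 9) - Real.log (4 / 9) ≤ 0.4 := by
    have : -Real.log (14 / 9) - Real.log (4 / 9) = Real.log (81 / 56) := by
      rw [← Real.log_inv, ← Real.log_div (by norm_num) (by norm_num)]; norm_num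
    rw [this, Real.log_le_iff_le_exp (by norm_num)]
    refine le_trans ?_ (Real.quadratic_le_exp_of_nonneg (by norm_num))
    norm_num
  unfold logCorrection
  norm_num at *
  linarith

/-- By convexity the function lies below its chords through `0`, `1/2` and `5/9`; here `5/9 = 2 (1/4
+ 1/36)` is the largest argument allowed by `y ≤ 1/6`. The first chord is `9/8 e`. The second
exceeds it by `27/8 (e - 1/4) ≤ 27/8 y² ≤ 9/16 y`. -/
lemma logCorrection_le {e y : ℝ} (h0 : 0 ≤ e) (hy0 : 0 ≤ y) (hy : y ≤ 1 / 6)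
    (he : e ≤ 1 / 4 + y ^ 2) : logCorrection (2 * e) ≤ 9 / 8 * (e + y / 2) := by
  have z0 : logCorrection 0 = 0 := by simp [logCorrection]
  rcases le_total e (1 / 4) with h | h
  · have := convexOn_logCorrection.2 (show (0 : ℝ) ∈ Set.Ioo (-1) 1 by norm_num)
      (show (1 / 2 : ℝ) ∈ Set.Ioo (-1) 1 by norm_num) (show 0 ≤ 1 - 4 * e by linarith)
      (show 0 ≤ 4 * e by linarith) (by ring)
    simp only [smul_eq_mul, z0] at this
    rw [show (1 - 4 * e) * 0 + 4 * e * (1 / 2) = 2 * e by ring] at this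
    nlinarith [logCorrection_half_le]
  · have he2 : e ≤ 5 / 18 := by nlinarith
    have := convexOn_logCorrection.2 (show (1 / 2 : ℝ) ∈ Set.Ioo (-1) 1 by norm_num)
      (show (5 / 9 : ℝ) ∈ Set.Ioo (-1) 1 by norm_num) (show 0 ≤ 10 - 36 * e by linarith)
      (show 0 ≤ 36 * e - 9 by linarith) (by ring)
    simp only [smul_eq_mul] at this
    rw [show (10 - 36 * e) * (1 / 2) + (36 * e - 9) * (5 / 9) = 2 * e by ring] at this
    have h1 := mul_le_mul_of_nonneg_left logCorrection_half_le (by linarith : 0 ≤ 10 - 36 * e)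
    have h2 := mul_le_mul_of_nonneg_left logCorrection_five_ninth_le
      (by linarith : 0 ≤ 36 * e - 9)
    nlinarith

lemma exp_logCorrection {e : ℝ} (he : |e| < 1 / 2) :
    (√(1 - 4 * e ^ 2))⁻¹ = Real.exp (-(e * logit e) / 2) * Real.exp (logCorrection (2 * |e|)) := by
  rw [← mul_logit_abs, ← sq_abs]
  have h0 := abs_nonneg e
  have he' : |(|e|)| < 1 / 2 := by rwa [abs_abs]
  generalize |e| = a at *
  have he2 : a < 1 / 2 := by rwa [abs_of_nonneg h0] at he'
  have h1 : (0 : ℝ) < 1 + 2 * a := by linarith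
  have h2 : (0 : ℝ) < 1 - 2 * a := by linarith
  rw [show 1 - 4 * a ^ 2 = (1 + 2 * a) * (1 - 2 * a) by ring, ← Real.exp_log (mul_pos h1 h2),
    ← Real.exp_half, ← Real.exp_neg, ← Real.exp_add, Real.log_mul h1.ne' h2.ne', logit_eq he',
    logCorrection]
  congr 1
  ring

/-- The Taylor remainder of order four is at most `5/96 u⁴` for each of `exp u` and `exp (-u)`. -/
lemma cosh_le_quartic {u : ℝ} (h : |u| ≤ 1) :
    2 * Real.cosh u ≤ 2 + u ^ 2 + 5 / 48 * u ^ 4 := by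
  have h1 := Real.exp_bound h (n := 4) (by norm_num)
  have h2 := Real.exp_bound (x := -u) (by rwa [abs_neg]) (n := 4) (by norm_num)
  rw [abs_neg] at h2
  have h3 : |u| ^ 4 = u ^ 4 := by rw [show (4 : ℕ) = 2 * 2 by norm_num, pow_mul, sq_abs, ← pow_mul]
  rw [h3] at h1 h2
  have h4 := (abs_le.1 h1).2
  have h5 := (abs_le.1 h2).2
  simp only [Finset.sum_range_succ, Finset.sum_range_zero, Nat.factorial] at h4 h5
  norm_num at h4 h5
  rw [Real.cosh_eq]
  nlinarith

lemma exp_nine_eighth_le : Real.exp (9 / 8) ≤ 3.081 := by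
  have h3 : Real.exp (9 / 8) ^ 8 ≤ (3.081 : ℝ) ^ 8 := by
    rw [← Real.exp_nat_mul, show ((8 : ℕ) : ℝ) * (9 / 8) = (9 : ℕ) * 1 by norm_num,
      Real.exp_nat_mul]
    calc Real.exp 1 ^ 9 ≤ 2.7182818286 ^ 9 := by gcongr; exact Real.exp_one_lt_d9.le
      _ ≤ _ := by norm_num
  exact (pow_le_pow_iff_left₀ (Real.exp_pos _).le (by norm_num) (by norm_num)).1 h3

/-- For fixed `u` the left side is convex in `E` and the right side affine, so only the endpoints `E
= 0` and `E = 1 - u` matter. At the second one the right side is `4`, whence the numerical bound for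
`exp (9/8)`. -/
lemma exp_mul_cosh_le {u E : ℝ} (hu : 0 ≤ u) (hE : 0 ≤ E) (h : u + E ≤ 1) :
    Real.exp (9 / 8 * E) * (2 * Real.cosh u - max (1 - 2 * u) 0) ≤ 1 + 3 * (u + E) := by
  have hu1 : u ≤ 1 := by linarith
  have hc := cosh_le_quartic (u := u) (by rw [abs_of_nonneg hu]; exact hu1)
  have hc1 := Real.one_le_cosh u
  set G := 2 * Real.cosh u - max (1 - 2 * u) 0 with hG
  have hG0 : 0 ≤ G := by
    have : max (1 - 2 * u) 0 ≤ 1 := max_le (by linarith) zero_le_one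
    linarith
  have hm1 : 1 - 2 * u ≤ max (1 - 2 * u) 0 := le_max_left _ _
  have hm2 : 0 ≤ max (1 - 2 * u) 0 := le_max_right _ _
  have u2 : 0 ≤ u ^ 2 := by positivity
  have hG1 : G ≤ 1 + 3 * u := by
    rcases le_total u (1 / 2) with h' | h'
    · have h2 : u ^ 2 ≤ u / 2 := by nlinarith
      have h4 : u ^ 4 ≤ u / 4 := by nlinarith
      linarith
    · have h2 : u ^ 2 ≤ 3 / 2 * u - 1 / 2 := by nlinarith
      have h4 : u ^ 4 ≤ 1 := pow_le_one₀ hu hu1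
      linarith
  have hexp : 1 + 9 / 8 * u + 81 / 128 * u ^ 2 + 243 / 1024 * u ^ 3 ≤ Real.exp (9 / 8 * u) := by
    have := Real.sum_le_exp_of_nonneg (x := 9 / 8 * u) (by linarith) 4
    simp only [Finset.sum_range_succ, Finset.sum_range_zero, Nat.factorial] at this
    norm_num at this
    nlinarith
  have hG2 : 3.081 * G ≤ 4 * Real.exp (9 / 8 * u) := by
    rcases le_total u (1 / 2) with h' | h'
    · have u3 : 0 ≤ u ^ 3 := by positivity
      have u2' : u ^ 2 ≤ u / 2 := by nlinarith
      have u4 : u ^ 4 ≤ u ^ 3 / 2 := by nlinarith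
      nlinarith
    · have u3 : 1 / 8 ≤ u ^ 3 := by
        calc (1 / 8 : ℝ) = (1 / 2) ^ 3 := by norm_num
          _ ≤ u ^ 3 := by gcongr
      have u4 : u ^ 4 ≤ 15 / 8 * u - 7 / 8 := by
        nlinarith [mul_nonneg (sub_nonneg.2 h') (sub_nonneg.2 hu1),
          mul_nonneg (mul_nonneg (sub_nonneg.2 h') (sub_nonneg.2 hu1)) u2,
          mul_nonneg (mul_nonneg (sub_nonneg.2 h') (sub_nonneg.2 hu1)) hu]
      nlinarith
  have hG3 : Real.exp (9 / 8 * (1 - u)) * G ≤ 4 := by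
    rw [show 9 / 8 * (1 - u) = 9 / 8 - 9 / 8 * u by ring, Real.exp_sub, div_mul_eq_mul_div,
      div_le_iff₀ (Real.exp_pos _)]
    exact (mul_le_mul_of_nonneg_right exp_nine_eighth_le hG0).trans hG2
  -- For `u = 1` the interval for `E` degenerates and the ratio `E / (1 - u)` is meaningless.
  rcases eq_or_lt_of_le hu1 with h1 | h1
  · have : E = 0 := by linarith
    rw [this]; simpa using hG1
  have h2 : 0 < 1 - u := by linarith
  have hl0 : 0 ≤ E / (1 - u) := by positivity
  have hl1 : E / (1 - u) ≤ 1 := (div_le_one h2).2 (by linarith)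
  have := convexOn_exp.2 (Set.mem_univ 0) (Set.mem_univ (9 / 8 * (1 - u)))
    (sub_nonneg.2 hl1) hl0 (by ring)
  simp only [smul_eq_mul, mul_zero, zero_add, Real.exp_zero, mul_one] at this
  rw [show E / (1 - u) * (9 / 8 * (1 - u)) = 9 / 8 * E by field_simp] at this
  have hE' : E = E / (1 - u) * (1 - u) := by field_simp
  generalize E / (1 - u) = l at *
  calc Real.exp (9 / 8 * E) * G ≤ (1 - l + l * Real.exp (9 / 8 * (1 - u))) * G :=
        mul_le_mul_of_nonneg_right this hG0
    _ = (1 - l) * G + l * (Real.exp (9 / 8 * (1 - u)) * G) := by ring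
    _ ≤ (1 - l) * (1 + 3 * u) + l * 4 := by
        gcongr
    _ = 1 + 3 * (u + E) := by rw [hE']; ring

/-- The addition formulas mix `cosh` and `sinh`, so the two bounds must be carried through the
induction together. -/
lemma prod_add_prod_le {ι : Type*} [DecidableEq ι] (W : Finset ι) {v : ι → ℝ}
    (hv : ∀ i ∈ W, 0 ≤ v i) :
    ∏ i ∈ W, (1 + v i) + ∏ i ∈ W, (1 - v i) ≤ 2 * Real.cosh (∑ i ∈ W, v i) ∧
    ∏ i ∈ W, (1 + v i) - ∏ i ∈ W, (1 - v i) ≤ 2 * Real.sinh (∑ i ∈ W, v i) := by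
  induction W using Finset.induction_on with
  | empty => norm_num
  | insert i W hi ih =>
    have ⟨h1, h2⟩ := ih fun j hj => hv j (Finset.mem_insert_of_mem hj)
    have hvi := hv i (Finset.mem_insert_self i W)
    have hV : 0 ≤ ∑ i ∈ W, v i := Finset.sum_nonneg fun j hj => hv j (Finset.mem_insert_of_mem hj)
    rw [Finset.prod_insert hi, Finset.prod_insert hi, Finset.sum_insert hi, Real.cosh_add,
      Real.sinh_add]
    have h3 := Real.self_le_sinh_iff.2 hvi
    have h4 := Real.one_le_cosh (v i)
    have h5 := Real.sinh_nonneg_iff.2 hV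
    have h6 := Real.cosh_pos (∑ i ∈ W, v i)
    generalize ∏ i ∈ W, (1 + v i) = P at *
    generalize ∏ i ∈ W, (1 - v i) = M at *
    generalize Real.cosh (∑ i ∈ W, v i) = c at *
    generalize Real.sinh (∑ i ∈ W, v i) = s at *
    generalize Real.cosh (v i) = c' at *
    generalize Real.sinh (v i) = s' at *
    constructor
    · nlinarith [mul_le_mul_of_nonneg_left h2 hvi, mul_le_mul_of_nonneg_right h3 h5,
        mul_le_mul_of_nonneg_right h4 h6.le]
    · nlinarith [mul_le_mul_of_nonneg_left h1 hvi, mul_le_mul_of_nonneg_right h3 h6.le,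
        mul_le_mul_of_nonneg_right h4 h5]

lemma one_sub_sum_le_prod {ι : Type*} [DecidableEq ι] (W : Finset ι) {v : ι → ℝ}
    (hv : ∀ i ∈ W, 0 ≤ v i) (hv1 : ∀ i ∈ W, v i ≤ 1) :
    1 - ∑ i ∈ W, v i ≤ ∏ i ∈ W, (1 - v i) := by
  induction W using Finset.induction_on with
  | empty => simp
  | insert i W hi ih =>
    have h1 := ih (fun j hj => hv j (Finset.mem_insert_of_mem hj))
      fun j hj => hv1 j (Finset.mem_insert_of_mem hj)
    have h2 := hv i (Finset.mem_insert_self i W)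
    have h3 := hv1 i (Finset.mem_insert_self i W)
    have hV : 0 ≤ ∑ i ∈ W, v i := Finset.sum_nonneg fun j hj => hv j (Finset.mem_insert_of_mem hj)
    rw [Finset.prod_insert hi, Finset.sum_insert hi]
    nlinarith

/-- The correction factor of a set of voters that vote for the wrong side. -/
theorem prod_correction_mul_le {ι : Type*} [DecidableEq ι] (W : Finset ι) {a e y : ι → ℝ}
    (ha0 : ∀ i ∈ W, 0 ≤ a i) (ha : ∀ i ∈ W, a i ≤ 1 / 2) (he0 : ∀ i ∈ W, 0 ≤ e i)
    (hy0 : ∀ i ∈ W, 0 ≤ y i) (hy : ∀ i ∈ W, y i ≤ 1 / 6) (he : ∀ i ∈ W, e i ≤ 1 / 4 + y i ^ 2)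
    (hsum : ∑ i ∈ W, (a i + e i) + 5 / 6 * ∑ i ∈ W, y i ≤ 1) :
    (∏ i ∈ W, Real.exp (logCorrection (2 * e i))) *
      (∏ i ∈ W, (1 + 4 * a i * e i) + ∏ i ∈ W, (1 - 4 * a i * e i) - ∏ i ∈ W, (1 - 2 * a i))
      ≤ 1 + 3 * ∑ i ∈ W, (a i + e i) + 5 / 2 * ∑ i ∈ W, y i := by
  rw [Finset.sum_add_distrib] at *
  have ha' := Finset.sum_nonneg ha0
  have he' := Finset.sum_nonneg he0
  have hy' := Finset.sum_nonneg hy0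
  set A := ∑ i ∈ W, a i
  set E := ∑ i ∈ W, e i
  set Z := ∑ i ∈ W, y i
  have hK : ∏ i ∈ W, Real.exp (logCorrection (2 * e i)) ≤ Real.exp (9 / 8 * (E + Z / 2)) := by
    rw [← Real.exp_sum, Real.exp_le_exp]
    calc ∑ i ∈ W, logCorrection (2 * e i) ≤ ∑ i ∈ W, 9 / 8 * (e i + y i / 2) :=
          Finset.sum_le_sum fun i hi =>
            logCorrection_le (he0 i hi) (hy0 i hi) (hy i hi) (he i hi)
      _ = 9 / 8 * (E + Z / 2) := by
          rw [← Finset.mul_sum, Finset.sum_add_distrib, ← Finset.sum_div]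
  have hv0 : ∀ i ∈ W, 0 ≤ 4 * a i * e i := fun i hi => by
    have := ha0 i hi
    have := he0 i hi
    positivity
  -- Here `4 a e ≤ a + 4 a y²`, and `4 a y² ≤ 2 y² ≤ y/3` because `a ≤ 1/2` and `y ≤ 1/6`.
  have hV : ∑ i ∈ W, 4 * a i * e i ≤ A + Z / 3 := by
    calc ∑ i ∈ W, 4 * a i * e i ≤ ∑ i ∈ W, (a i + y i / 3) :=
          Finset.sum_le_sum fun i hi => by
            have h1 := ha0 i hi
            have h2 := mul_le_mul_of_nonneg_left (he i hi) (by linarith : 0 ≤ 4 * a i)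
            have h3 := ha i hi
            have h4 := hy i hi
            have h5 := hy0 i hi
            have h6 : a i * y i ^ 2 ≤ 1 / 2 * y i ^ 2 :=
              mul_le_mul_of_nonneg_right h3 (sq_nonneg _)
            nlinarith
      _ = A + Z / 3 := by rw [Finset.sum_add_distrib, ← Finset.sum_div]
  have hV0 := Finset.sum_nonneg hv0
  have hPM := (prod_add_prod_le W hv0).1
  have hcosh : Real.cosh (∑ i ∈ W, 4 * a i * e i) ≤ Real.cosh (A + Z / 3) := by
    rw [Real.cosh_le_cosh, abs_of_nonneg hV0, abs_of_nonneg (hV0.trans hV)]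
    exact hV
  have hQ : max (1 - 2 * (A + Z / 3)) 0 ≤ ∏ i ∈ W, (1 - 2 * a i) := by
    refine max_le ?_ (Finset.prod_nonneg fun i hi => by have := ha i hi; linarith)
    have := one_sub_sum_le_prod W (v := fun i => 2 * a i)
      (fun i hi => by have := ha0 i hi; linarith) fun i hi => by have := ha i hi; linarith
    rw [← Finset.mul_sum] at this
    linarith
  have hG : 0 ≤ 2 * Real.cosh (A + Z / 3) - max (1 - 2 * (A + Z / 3)) 0 := by
    have : max (1 - 2 * (A + Z / 3)) 0 ≤ 1 := max_le (by linarith) zero_le_one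
    linarith [Real.one_le_cosh (A + Z / 3)]
  have hK0 : 0 ≤ ∏ i ∈ W, Real.exp (logCorrection (2 * e i)) :=
    Finset.prod_nonneg fun i _ => (Real.exp_pos _).le
  calc _ ≤ (∏ i ∈ W, Real.exp (logCorrection (2 * e i))) *
        (2 * Real.cosh (A + Z / 3) - max (1 - 2 * (A + Z / 3)) 0) :=
        mul_le_mul_of_nonneg_left (by linarith) hK0
    _ ≤ Real.exp (9 / 8 * (E + Z / 2)) *
        (2 * Real.cosh (A + Z / 3) - max (1 - 2 * (A + Z / 3)) 0) :=
        mul_le_mul_of_nonneg_right hK hG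
    _ ≤ 1 + 3 * ((A + Z / 3) + (E + Z / 2)) :=
        exp_mul_cosh_le (by linarith) (by linarith) (by linarith)
    _ = _ := by ring

end RealBounds

/-! ### Votes with weights in the extended reals. -/

section VoteError

lemma naiveBayesWeight_one : naiveBayesWeight 1 = ⊤ := by
  simp [naiveBayesWeight]

lemma naiveBayesWeight_zero : naiveBayesWeight 0 = ⊥ := by
  simp [naiveBayesWeight]

lemma naiveBayesWeight_eq_logit {q : ℝ} (h0 : 0 < q) (h1 : q < 1) :
    naiveBayesWeight q = ((logit (q - 1 / 2) : ℝ) : EReal) := by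
  rw [naiveBayesWeight, logit, ← ENNReal.ofReal_div_of_pos (by linarith),
    ENNReal.log_ofReal_of_pos (div_pos h0 (by linarith))]
  congr 3 <;> ring

lemma naiveBayesWeight_nonneg {q : ℝ} (h : 1 / 2 ≤ q) (h1 : q ≤ 1) : 0 ≤ naiveBayesWeight q := by
  rcases eq_or_lt_of_le h1 with rfl | h1
  · rw [naiveBayesWeight_one]; exact le_top
  · rw [naiveBayesWeight_eq_logit (by linarith) h1]
    have : 0 ≤ logit (q - 1 / 2) := by
      refine Real.log_nonneg ?_
      rw [le_div_iff₀ (by linarith)]; linarith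
    exact_mod_cast this

lemma naiveBayesWeight_nonpos {q : ℝ} (h : q ≤ 1 / 2) (h0 : 0 ≤ q) : naiveBayesWeight q ≤ 0 := by
  rcases eq_or_lt_of_le h0 with rfl | h0
  · rw [naiveBayesWeight_zero]; exact bot_le
  · rw [naiveBayesWeight_eq_logit h0 (by linarith)]
    have : logit (q - 1 / 2) ≤ 0 := by
      refine Real.log_nonpos (div_nonneg (by linarith) (by linarith)) ?_
      rw [div_le_one (by linarith)]; linarith
    exact_mod_cast this

variable {ι : Type*} [Fintype ι] [DecidableEq ι]

/-- The total weight of the votes for the positive side. -/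
noncomputable def posWeight (w : ι → EReal) (x : ι → ℤˣ) : ENNReal :=
  ∑ i, ((signVal (x i) : EReal) * w i).toENNReal

/-- The total weight of the votes for the negative side. -/
noncomputable def negWeight (w : ι → EReal) (x : ι → ℤˣ) : ENNReal :=
  ∑ i, (-((signVal (x i) : EReal) * w i)).toENNReal

/-- The error of the weighted vote for the true state, a tie counting one half. -/
noncomputable def voteErr (w : ι → EReal) (x : ι → ℤˣ) : ℝ :=
  if negWeight w x < posWeight w x then 0
  else if posWeight w x < negWeight w x then 1 else 1 / 2

lemma voteErr_mem (w : ι → EReal) (x : ι → ℤˣ) : 0 ≤ voteErr w x ∧ voteErr w x ≤ 1 := by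
  unfold voteErr
  split_ifs <;> norm_num

lemma voteErr_le_of_le {w : ι → EReal} {x y : ι → ℤˣ} (hp : posWeight w y ≤ posWeight w x)
    (hn : negWeight w x ≤ negWeight w y) : voteErr w x ≤ voteErr w y := by
  by_cases h1 : negWeight w x < posWeight w x
  · rw [voteErr, if_pos h1]; exact (voteErr_mem w y).1
  · have h2 : ¬negWeight w y < posWeight w y := fun h => h1 (hn.trans_lt (h.trans_le hp))
    by_cases h3 : posWeight w x < negWeight w x
    · have h4 : posWeight w y < negWeight w y := hp.trans_lt (h3.trans_le hn)
      rw [voteErr, voteErr, if_neg h1, if_neg h2, if_pos h3, if_pos h4]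
    · rw [voteErr, voteErr, if_neg h1, if_neg h2, if_neg h3]
      split_ifs <;> norm_num

lemma voteErr_le_voteErr {w : ι → EReal} {k : ι} {x y : ι → ℤˣ} (hxy : ∀ i, i ≠ k → x i = y i)
    (hk : (signVal (y k) : EReal) * w k ≤ (signVal (x k) : EReal) * w k) :
    voteErr w x ≤ voteErr w y := by
  have h : ∀ i, (signVal (y i) : EReal) * w i ≤ (signVal (x i) : EReal) * w i := fun i => by
    by_cases hi : i = k
    · rw [hi]; exact hk
    · rw [hxy i hi]
  exact voteErr_le_of_le (Finset.sum_le_sum fun i _ => EReal.toENNReal_le_toENNReal (h i))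
    (Finset.sum_le_sum fun i _ => EReal.toENNReal_le_toENNReal (EReal.neg_le_neg_iff.2 (h i)))

/-- A vote of nonnegative weight for the true state cannot increase the error. The one-sided range
of the influence makes only one direction of a parameter change costly. -/
lemma voteErr_influence {w : ι → EReal} {k : ι} (hw : 0 ≤ w k) (x : ι → ℤˣ) :
    -1 ≤ signVal (x k) * (voteErr w x - voteErr w (flipAt k x)) ∧
      signVal (x k) * (voteErr w x - voteErr w (flipAt k x)) ≤ 0 := by
  have h1 := voteErr_mem w x
  have h2 := voteErr_mem w (flipAt k x)
  have hneg : -w k ≤ w k := (by simpa using EReal.neg_le_neg_iff.2 hw : -w k ≤ 0).trans hw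
  rcases signVal_eq (x k) with h | h
  · have := voteErr_le_voteErr (w := w) (k := k) (x := x) (y := flipAt k x)
      (fun i hi => (flipAt_of_ne hi x).symm) (by simpa [h] using hneg)
    rw [h]; constructor <;> linarith
  · have := voteErr_le_voteErr (w := w) (k := k) (x := flipAt k x) (y := x)
      (fun i hi => flipAt_of_ne hi x) (by simpa [h] using hneg)
    rw [h]; constructor <;> linarith

lemma voteErr_influence_of_nonpos {w : ι → EReal} {k : ι} (hw : w k ≤ 0) (x : ι → ℤˣ) :
    0 ≤ signVal (x k) * (voteErr w x - voteErr w (flipAt k x)) ∧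
      signVal (x k) * (voteErr w x - voteErr w (flipAt k x)) ≤ 1 := by
  have h1 := voteErr_mem w x
  have h2 := voteErr_mem w (flipAt k x)
  have hneg : w k ≤ -w k := hw.trans (by simpa using EReal.neg_le_neg_iff.2 hw : 0 ≤ -w k)
  rcases signVal_eq (x k) with h | h
  · have := voteErr_le_voteErr (w := w) (k := k) (x := flipAt k x) (y := x)
      (fun i hi => flipAt_of_ne hi x) (by simpa [h] using hneg)
    rw [h]; constructor <;> linarith
  · have := voteErr_le_voteErr (w := w) (k := k) (x := x) (y := flipAt k x)
      (fun i hi => (flipAt_of_ne hi x).symm) (by simpa [h] using hneg)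
    rw [h]; constructor <;> linarith

lemma voteErr_coe (w : ι → ℝ) (x : ι → ℤˣ) :
    voteErr (fun i => (w i : EReal)) x = errSign (∑ i, w i * signVal (x i)) := by
  have hp : posWeight (fun i => (w i : EReal)) x
      = ENNReal.ofReal (∑ i, max (w i * signVal (x i)) 0) := by
    rw [ENNReal.ofReal_sum_of_nonneg fun i _ => le_max_right _ _]
    refine Finset.sum_congr rfl fun i _ => ?_
    rw [← EReal.coe_mul, EReal.toENNReal_of_ne_top (EReal.coe_ne_top _), EReal.toReal_coe, mul_comm]
    rcases le_total (w i * signVal (x i)) 0 with h | h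
    · rw [max_eq_right h, ENNReal.ofReal_of_nonpos h, ENNReal.ofReal_zero]
    · rw [max_eq_left h]
  have hn : negWeight (fun i => (w i : EReal)) x
      = ENNReal.ofReal (∑ i, max (-(w i * signVal (x i))) 0) := by
    rw [ENNReal.ofReal_sum_of_nonneg fun i _ => le_max_right _ _]
    refine Finset.sum_congr rfl fun i _ => ?_
    rw [← EReal.coe_mul, ← EReal.coe_neg, EReal.toENNReal_of_ne_top (EReal.coe_ne_top _),
      EReal.toReal_coe, mul_comm]
    rcases le_total (-(w i * signVal (x i))) 0 with h | h
    · rw [max_eq_right h, ENNReal.ofReal_of_nonpos h, ENNReal.ofReal_zero]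
    · rw [max_eq_left h]
  have hsum : ∑ i, w i * signVal (x i) = ∑ i, max (w i * signVal (x i)) 0
      - ∑ i, max (-(w i * signVal (x i))) 0 := by
    rw [← Finset.sum_sub_distrib]
    refine Finset.sum_congr rfl fun i _ => ?_
    rcases le_total (w i * signVal (x i)) 0 with h | h
    · rw [max_eq_right h, max_eq_left (by linarith)]; ring
    · rw [max_eq_left h, max_eq_right (by linarith)]; ring
  have h1 : 0 ≤ ∑ i, max (w i * signVal (x i)) 0 := Finset.sum_nonneg fun i _ => le_max_right _ _
  have h2 : 0 ≤ ∑ i, max (-(w i * signVal (x i))) 0 :=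
    Finset.sum_nonneg fun i _ => le_max_right _ _
  unfold voteErr errSign
  rw [hp, hn, hsum]
  generalize ∑ i, max (w i * signVal (x i)) 0 = a at *
  generalize ∑ i, max (-(w i * signVal (x i))) 0 = b at *
  have e1 : ENNReal.ofReal b < ENNReal.ofReal a ↔ 0 < a - b := by
    rw [ENNReal.ofReal_lt_ofReal_iff_of_nonneg h2, sub_pos]
  have e2 : ENNReal.ofReal a < ENNReal.ofReal b ↔ a - b < 0 := by
    rw [ENNReal.ofReal_lt_ofReal_iff_of_nonneg h1, sub_neg]
  simp only [e1, e2]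

/-- With infinite weights the vote is right if all the voters of infinite weight are right. -/
lemma signMean_voteErr_eq_zero {n q : ι → ℝ} (hq : ∀ i, 0 ≤ q i ∧ q i ≤ 1)
    (hn : ∀ i, (q i = 0 ∨ q i = 1) → n i = q i - 1 / 2) (hex : ∃ i, q i = 0 ∨ q i = 1) :
    signMean n (voteErr fun i => naiveBayesWeight (q i)) = 0 := by
  refine Finset.sum_eq_zero fun x _ => ?_
  by_cases hx : ∀ i, (q i = 0 → x i = -1) ∧ (q i = 1 → x i = 1)
  · have hterm : ∀ i, (q i = 0 ∨ q i = 1) →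
        (signVal (x i) : EReal) * naiveBayesWeight (q i) = ⊤ := by
      rintro i (h | h)
      · rw [(hx i).1 h, h, naiveBayesWeight_zero]; simp
      · rw [(hx i).2 h, h, naiveBayesWeight_one]; simp
    obtain ⟨k, hk⟩ := hex
    have hpos : posWeight (fun i => naiveBayesWeight (q i)) x = ⊤ := by
      refine top_unique ?_
      calc (⊤ : ENNReal) = ((signVal (x k) : EReal) * naiveBayesWeight (q k)).toENNReal := by
            rw [hterm k hk, EReal.toENNReal_top]
        _ ≤ _ := Finset.single_le_sum
            (f := fun i => ((signVal (x i) : EReal) * naiveBayesWeight (q i)).toENNReal)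
            (fun i _ => zero_le) (Finset.mem_univ k)
    have hneg : negWeight (fun i => naiveBayesWeight (q i)) x < ⊤ := by
      refine ENNReal.sum_lt_top.2 fun i _ => ?_
      by_cases hi : q i = 0 ∨ q i = 1
      · rw [hterm i hi]; simp
      · push Not at hi
        simp only
        rw [naiveBayesWeight_eq_logit (lt_of_le_of_ne (hq i).1 hi.1.symm)
          (lt_of_le_of_ne (hq i).2 hi.2), ← EReal.coe_mul, ← EReal.coe_neg,
          EReal.toENNReal_of_ne_top (EReal.coe_ne_top _)]
        exact ENNReal.ofReal_lt_top
    rw [voteErr, hpos, if_pos hneg, mul_zero]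
  · push Not at hx
    obtain ⟨i, hi⟩ := hx
    have : signMass n x = 0 := by
      refine Finset.prod_eq_zero (Finset.mem_univ i) ?_
      by_cases h0 : q i = 0 ∧ x i ≠ -1
      · rw [hn i (Or.inl h0.1), h0.1, (Int.units_eq_one_or (x i)).resolve_right h0.2]
        norm_num
      · have h1 := hi fun h => by_contra fun h' => h0 ⟨h, h'⟩
        rw [hn i (Or.inr h1.1), h1.1, (Int.units_eq_one_or (x i)).resolve_left h1.2]
        norm_num
    rw [this, zero_mul]

/-- For two voters of equal weight, a disagreement is a tie. -/
lemma voteErr_of_ne (hcard : Fintype.card ι = 2) {w : ι → EReal} (hw : ∀ i j, w i = w j)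
    {x : ι → ℤˣ} {i j : ι} (hx : x i ≠ x j) : voteErr w x = 1 / 2 := by
  have hij : i ≠ j := fun h => hx (by rw [h])
  have huniv : (Finset.univ : Finset ι) = {i, j} := by
    symm
    rw [← Finset.card_eq_iff_eq_univ, Finset.card_pair hij, hcard]
  have hj : x j = -x i := by
    rcases Int.units_eq_one_or (x i) with h | h <;>
      rcases Int.units_eq_one_or (x j) with h' | h' <;> simp_all
  have : posWeight w x = negWeight w x := by
    rw [posWeight, negWeight, huniv, Finset.sum_pair hij, Finset.sum_pair hij, hj, hw j i, add_comm]
    simp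
  rw [voteErr, this]
  simp

end VoteError

/-! ### Replacing the true parameters by those for which the weights are ideal. -/

section Coupling

variable {ι : Type*} [Fintype ι] [DecidableEq ι]

lemma signMean_voteErr_le_one {m : ι → ℝ} (hm : ∀ i, |m i| ≤ 1 / 2) (w : ι → EReal) :
    signMean m (voteErr w) ≤ 1 :=
  (signMean_mono hm fun x => (voteErr_mem w x).2).trans_eq (signMean_const m 1)

/-- Replacing the parameters on `S` one after the other. -/
lemma signMean_piecewise_le {m e D : ι → ℝ} (hm : ∀ i, |m i| ≤ 1 / 2) (he : ∀ i, |e i| ≤ 1 / 2)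
    {F : (ι → ℤˣ) → ℝ} (S : Finset ι)
    (h : ∀ i ∈ S, ∀ n : ι → ℝ, (∀ k, |n k| ≤ 1 / 2) → n i = m i →
      signMean n F ≤ signMean (Function.update n i (e i)) F + D i) :
    signMean m F ≤ signMean (S.piecewise e m) F + ∑ i ∈ S, D i := by
  induction S using Finset.induction_on with
  | empty => simp
  | insert i S hi ih =>
    have h1 := ih fun j hj => h j (Finset.mem_insert_of_mem hj)
    have h2 := h i (Finset.mem_insert_self i S) (S.piecewise e m) (fun k => by
      by_cases hk : k ∈ S
      · rw [Finset.piecewise_eq_of_mem _ _ _ hk]; exact he k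
      · rw [Finset.piecewise_eq_of_notMem _ _ _ hk]; exact hm k)
      (Finset.piecewise_eq_of_notMem _ _ _ hi)
    rw [Finset.piecewise_insert, Finset.sum_insert hi]
    linarith

/-- The cost of replacing the parameter `a` of a voter by `e`, for weights ideal for `e`. -/
noncomputable def switchCost (a e : ℝ) : ℝ := 
  if 0 < e then max (e - a) 0 else if e < 0 then max (a - e) 0 else 0

/-- The expectation changes by `(n i - e i) β` for some average influence `β`, which lies in `[-1,
0]` for a nonnegative weight and in `[0, 1]` for a nonpositive one. A zero weight satisfies both, so
`β = 0`. -/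
lemma signMean_update_le {n q : ι → ℝ} (hn : ∀ k, |n k| ≤ 1 / 2)
    (hq : ∀ i, 0 ≤ q i ∧ q i ≤ 1) (i : ι) :
    signMean n (voteErr fun i => naiveBayesWeight (q i))
      ≤ signMean (Function.update n i (q i - 1 / 2)) (voteErr fun i => naiveBayesWeight (q i))
        + switchCost (n i) (q i - 1 / 2) := by
  set w : ι → EReal := fun i => naiveBayesWeight (q i) with hw
  have hpos : 0 ≤ q i - 1 / 2 → 0 ≤ w i := fun h => naiveBayesWeight_nonneg (by linarith) (hq i).2
  have hneg : q i - 1 / 2 ≤ 0 → w i ≤ 0 := fun h => naiveBayesWeight_nonpos (by linarith) (hq i).1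
  unfold switchCost
  split_ifs with h h'
  · obtain ⟨β, h1, h2, h3⟩ := exists_signMean_eq_update_add i (fun k _ => hn k) (q i - 1 / 2)
      (fun x => (voteErr_influence (hpos h.le) x).1) (fun x => (voteErr_influence (hpos h.le) x).2)
    rw [h3]
    have := mul_le_mul_of_nonneg_right (le_max_left (q i - 1 / 2 - n i) 0)
      (by linarith : 0 ≤ -β)
    nlinarith [le_max_right (q i - 1 / 2 - n i) 0]
  · obtain ⟨β, h1, h2, h3⟩ := exists_signMean_eq_update_add i (fun k _ => hn k) (q i - 1 / 2)
      (fun x => (voteErr_influence_of_nonpos (hneg h'.le) x).1)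
      (fun x => (voteErr_influence_of_nonpos (hneg h'.le) x).2)
    rw [h3]
    have := mul_le_mul_of_nonneg_right (le_max_left (n i - (q i - 1 / 2)) 0) h1
    nlinarith [le_max_right (n i - (q i - 1 / 2)) 0]
  · obtain ⟨β, h1, h2, h3⟩ := exists_signMean_eq_update_add i (fun k _ => hn k) (q i - 1 / 2)
      (fun x => (voteErr_influence_of_nonpos (hneg (not_lt.1 h)) x).1)
      (fun x => (voteErr_influence (hpos (not_lt.1 h')) x).2)
    rw [h3, le_antisymm h2 h1]
    simp

/-- For two voters of equal weight the influence of each of them is halved. -/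
lemma signMean_update_le_of_two (hcard : Fintype.card ι = 2) {n q : ι → ℝ}
    (hn : ∀ k, |n k| ≤ 1 / 2) (hqq : ∀ i j, q i = q j) (i : ι) :
    signMean n (voteErr fun i => naiveBayesWeight (q i))
      ≤ signMean (Function.update n i (q i - 1 / 2)) (voteErr fun i => naiveBayesWeight (q i))
        + 1 / 2 * |n i - (q i - 1 / 2)| := by
  set w : ι → EReal := fun i => naiveBayesWeight (q i) with hw
  have hww : ∀ i j, w i = w j := fun i j => by rw [hw]; simp only [hqq i j]
  obtain ⟨j, hj⟩ : ∃ j, j ≠ i := by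
    have : Nontrivial ι := Fintype.one_lt_card_iff_nontrivial.1 (by omega)
    exact exists_ne i
  have hinf : ∀ x, |signVal (x i) * (voteErr w x - voteErr w (flipAt i x))| ≤ 1 / 2 := by
    intro x
    have h1 := voteErr_mem w x
    have h2 := voteErr_mem w (flipAt i x)
    have h3 : |voteErr w x - voteErr w (flipAt i x)| ≤ 1 / 2 := by
      rw [abs_le]
      by_cases hx : x i = x j
      · have : voteErr w (flipAt i x) = 1 / 2 := by
          refine voteErr_of_ne hcard hww (i := i) (j := j) ?_
          rw [flipAt_same, flipAt_of_ne hj, hx]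
          rcases Int.units_eq_one_or (x j) with h | h <;> rw [h] <;> decide
        rw [this]; constructor <;> linarith
      · rw [voteErr_of_ne hcard hww hx]; constructor <;> linarith
    rw [abs_mul]
    rcases signVal_eq (x i) with h | h <;> rw [h] <;> simpa using h3
  obtain ⟨β, h1, h2, h3⟩ := exists_signMean_eq_update_add i (fun k _ => hn k) (q i - 1 / 2)
    (fun x => (abs_le.1 (hinf x)).1) (fun x => (abs_le.1 (hinf x)).2)
  rw [h3]
  have h4 : (n i - (q i - 1 / 2)) * β ≤ |n i - (q i - 1 / 2)| * |β| := by
    rw [← abs_mul]; exact le_abs_self _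
  have h5 := mul_le_mul_of_nonneg_left (abs_le.2 ⟨h1, h2⟩) (abs_nonneg (n i - (q i - 1 / 2)))
  linarith

/-- The weight `2 r⁻ + r⁺`, or its mirror image for a voter of negative lean `a`, of a deviation
`r` of the empirical pseudo competence. -/
noncomputable def deviationCost (a r : ℝ) : ℝ :=
  if 0 ≤ a then max r 0 + 2 * max (-r) 0 else 2 * max r 0 + max (-r) 0

lemma half_abs_le_deviationCost (a r : ℝ) : 1 / 2 * |r| ≤ deviationCost a r := by
  have h1 := le_max_left r 0
  have h2 := le_max_left (-r) 0
  have h3 := le_max_right r 0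
  have h4 := le_max_right (-r) 0
  have : |r| ≤ max r 0 + max (-r) 0 := abs_le'.2 ⟨by linarith, by linarith⟩
  unfold deviationCost
  split_ifs <;> linarith [abs_nonneg r]

lemma deviationCost_nonneg (a r : ℝ) : 0 ≤ deviationCost a r :=
  le_trans (by positivity) (half_abs_le_deviationCost a r)

/-- In this form the linear term drops out in expectation, since the empirical pseudo competence is
unbiased. -/
lemma deviationCost_eq (a r : ℝ) :
    deviationCost a r = 3 / 2 * |r| - (if 0 ≤ a then 1 / 2 else -1 / 2) * r := by
  unfold deviationCost
  rcases le_total 0 r with h | h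
  · rw [max_eq_left h, max_eq_right (by linarith : -r ≤ 0), abs_of_nonneg h]
    split_ifs <;> ring
  · rw [max_eq_right h, max_eq_left (by linarith : 0 ≤ -r), abs_of_nonpos h]
    split_ifs <;> ring

/-- A voter whose weight has the right sign. -/
lemma switchCost_le {a g r : ℝ} (hg : |g| ≤ 1 / 2) (h : 0 ≤ a * (2 * a * g + r)) :
    switchCost a (2 * a * g + r) ≤ deviationCost a r := by
  have ⟨h1, h2⟩ := abs_le.1 hg
  have m1 := le_max_left r 0
  have m2 := le_max_left (-r) 0
  have m3 := le_max_right r 0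
  have m4 := le_max_right (-r) 0
  have h0 := deviationCost_nonneg a r
  unfold deviationCost at h0
  unfold switchCost deviationCost
  rcases lt_trichotomy (2 * a * g + r) 0 with h3 | h3 | h3
  · rw [if_neg h3.not_gt, if_pos h3]
    have ha : a ≤ 0 := by nlinarith
    refine max_le ?_ h0
    rcases eq_or_lt_of_le ha with rfl | ha
    · simp only [mul_zero, zero_mul, zero_add, zero_sub, le_refl, if_true]
      linarith
    · rw [if_neg (not_le.2 ha)]; nlinarith
  · rw [h3]; simpa using h0
  · rw [if_pos h3]
    have ha : 0 ≤ a := by nlinarith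
    refine max_le ?_ h0
    rw [if_pos ha]; nlinarith

/-- A voter whose weight has the wrong sign: the modulus of its empirical lean is `y` larger than
the one of its mean, and `y` is paid for by the deviation. -/
lemma wrong_sign_cost {a g r : ℝ} (h : a * (2 * a * g + r) < 0) :
    switchCost a (2 * a * g + r) = |a| + |2 * a * g + r| ∧
    deviationCost a r = 2 * max (|2 * a * g + r| + 2 * |a| * g) 0
      + max (-(|2 * a * g + r| + 2 * |a| * g)) 0 := by
  unfold switchCost deviationCost
  rcases lt_trichotomy a 0 with ha | ha | ha
  · have he : 0 < 2 * a * g + r := by nlinarith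
    rw [if_pos he, if_neg (not_le.2 ha), abs_of_neg ha, abs_of_pos he,
      max_eq_left (by linarith)]
    exact ⟨by ring, by ring_nf⟩
  · subst ha; simp at h
  · have he : 2 * a * g + r < 0 := by nlinarith
    rw [if_neg he.not_gt, if_pos he, if_pos ha.le, abs_of_pos ha, abs_of_neg he,
      max_eq_left (by linarith)]
    exact ⟨by ring, by ring_nf⟩

lemma prod_sqrt_le {e : ι → ℝ} (he : ∀ i, |e i| < 1 / 2) (S : Finset ι) :
    ∏ i ∈ S, √(1 - 4 * e i ^ 2) ≤ ∏ i ∈ S, Real.exp (-(e i * logit (e i)) / 2) :=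
  Finset.prod_le_prod (fun _ _ => Real.sqrt_nonneg _) fun i _ => sqrt_le_exp_potential (he i)

/-- The error of the vote with ideal weights off `W`. -/
lemma signMean_voteErr_le_of_eq_off {n q : ι → ℝ} {δ : ℝ} (W : Finset ι)
    (hq : ∀ i, 0 ≤ q i ∧ q i ≤ 1) (hn : ∀ i ∈ W, |n i| ≤ 1 / 2)
    (hnq : ∀ i, i ∉ W → n i = q i - 1 / 2) (hW : ∀ i ∈ W, 0 < q i ∧ q i < 1)
    (hsign : ∀ i ∈ W, n i * (q i - 1 / 2) ≤ 0) (hδ : 0 ≤ δ)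
    (hR : (∀ i, 0 < q i ∧ q i < 1) →
      Real.exp (-(∑ i, (q i - 1 / 2) * logit (q i - 1 / 2)) / 2) ≤ δ / 2)
    {B : ℝ} (hB0 : 0 ≤ B)
    (hB : (∏ i ∈ W, Real.exp (logCorrection (2 * |q i - 1 / 2|))) *
      (∏ i ∈ W, (1 + 4 * |n i| * |q i - 1 / 2|) + ∏ i ∈ W, (1 - 4 * |n i| * |q i - 1 / 2|)
        - ∏ i ∈ W, (1 - 2 * |n i|)) ≤ B) :
    signMean n (voteErr fun i => naiveBayesWeight (q i)) ≤ δ / 4 * B := by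
  -- Voters of infinite weight lie off `W`, where the law agrees with the weights: they are surely
  -- right after orientation by their weight, and the error vanishes.
  by_cases hex : ∃ i, q i = 0 ∨ q i = 1
  · rw [signMean_voteErr_eq_zero hq (fun i hi => hnq i fun hiW => ?_) hex]
    · positivity
    · have := hW i hiW
      rcases hi with h | h <;> rw [h] at this <;> linarith [this.1, this.2]
  push Not at hex
  have hq' : ∀ i, 0 < q i ∧ q i < 1 := fun i =>
    ⟨lt_of_le_of_ne (hq i).1 (hex i).1.symm, lt_of_le_of_ne (hq i).2 (hex i).2⟩
  have he : ∀ i, |q i - 1 / 2| < 1 / 2 := fun i => by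
    rw [abs_lt]; constructor <;> linarith [(hq' i).1, (hq' i).2]
  have hfun : (voteErr fun i => naiveBayesWeight (q i))
      = fun x : ι → ℤˣ => errSign (∑ i, logit (q i - 1 / 2) * signVal (x i)) := by
    funext x
    rw [← voteErr_coe]
    congr 1
    funext i
    exact naiveBayesWeight_eq_logit (hq' i).1 (hq' i).2
  rw [hfun]
  refine (signMean_errSign_le W hn he hnq).trans ?_
  -- The opposite signs on `W` exchange the two products in the error bound, whose sum is symmetric.
  have hprod : ∀ i ∈ W, 4 * n i * (q i - 1 / 2) = -(4 * |n i| * |q i - 1 / 2|) := fun i hi => by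
    rw [mul_assoc, mul_assoc, ← abs_mul, abs_of_nonpos (hsign i hi)]; ring
  have e1 : ∏ i ∈ W, (1 + 4 * n i * (q i - 1 / 2)) = ∏ i ∈ W, (1 - 4 * |n i| * |q i - 1 / 2|) :=
    Finset.prod_congr rfl fun i hi => by rw [hprod i hi]; ring
  have e2 : ∏ i ∈ W, (1 - 4 * n i * (q i - 1 / 2)) = ∏ i ∈ W, (1 + 4 * |n i| * |q i - 1 / 2|) :=
    Finset.prod_congr rfl fun i hi => by rw [hprod i hi]; ring
  rw [e1, e2, Finset.prod_congr rfl fun i _ => exp_logCorrection (he i), Finset.prod_mul_distrib]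
  set G := ∏ i ∈ W, (1 - 4 * |n i| * |q i - 1 / 2|) + ∏ i ∈ W, (1 + 4 * |n i| * |q i - 1 / 2|)
        - ∏ i ∈ W, (1 - 2 * |n i|) with hG
  have hB' : (∏ i ∈ W, Real.exp (logCorrection (2 * |q i - 1 / 2|))) * G ≤ B := by
    rw [hG, add_comm (∏ i ∈ W, (1 - 4 * |n i| * |q i - 1 / 2|))]; exact hB
  set K := ∏ i ∈ W, Real.exp (logCorrection (2 * |q i - 1 / 2|))
  have hpot : (∏ i ∈ Wᶜ, Real.exp (-((q i - 1 / 2) * logit (q i - 1 / 2)) / 2)) *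
      (∏ i ∈ W, Real.exp (-((q i - 1 / 2) * logit (q i - 1 / 2)) / 2)) ≤ δ / 2 := by
    refine le_trans (le_of_eq ?_) (hR hq')
    rw [mul_comm, Finset.prod_mul_prod_compl, ← Real.exp_sum, ← Finset.sum_div,
      Finset.sum_neg_distrib]
  have hsq := prod_sqrt_le he Wᶜ
  have hW0 : 0 ≤ ∏ i ∈ W, Real.exp (-((q i - 1 / 2) * logit (q i - 1 / 2)) / 2) :=
    Finset.prod_nonneg fun i _ => (Real.exp_pos _).le
  have hS0 : 0 ≤ ∏ i ∈ Wᶜ, √(1 - 4 * (q i - 1 / 2) ^ 2) :=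
    Finset.prod_nonneg fun i _ => Real.sqrt_nonneg _
  calc _ = 1 / 2 * ((∏ i ∈ Wᶜ, √(1 - 4 * (q i - 1 / 2) ^ 2)) *
        ∏ i ∈ W, Real.exp (-((q i - 1 / 2) * logit (q i - 1 / 2)) / 2)) * (K * G) := by ring
    _ ≤ 1 / 2 * ((∏ i ∈ Wᶜ, √(1 - 4 * (q i - 1 / 2) ^ 2)) *
        ∏ i ∈ W, Real.exp (-((q i - 1 / 2) * logit (q i - 1 / 2)) / 2)) * B :=
        mul_le_mul_of_nonneg_left hB' (by positivity)
    _ ≤ 1 / 2 * (δ / 2) * B := by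
        refine mul_le_mul_of_nonneg_right ?_ hB0
        refine mul_le_mul_of_nonneg_left ?_ (by norm_num)
        exact (mul_le_mul_of_nonneg_right hsq hW0).trans hpot
    _ = δ / 4 * B := by ring

/-- The ideal error. -/
lemma signMean_voteErr_ideal_le {q : ι → ℝ} {δ : ℝ} (hq : ∀ i, 0 ≤ q i ∧ q i ≤ 1) (hδ : 0 ≤ δ)
    (hR : (∀ i, 0 < q i ∧ q i < 1) →
      Real.exp (-(∑ i, (q i - 1 / 2) * logit (q i - 1 / 2)) / 2) ≤ δ / 2) :
    signMean (fun i => q i - 1 / 2) (voteErr fun i => naiveBayesWeight (q i)) ≤ δ / 4 := by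
  have := signMean_voteErr_le_of_eq_off (n := fun i => q i - 1 / 2) ∅ hq (by simp) (by simp)
    (by simp) (by simp) hδ hR zero_le_one (by simp)
  simpa using this

end Coupling

/-! ### The error bound for fixed weights. -/

section ErrorBound

variable {ι : Type*} [Fintype ι] [DecidableEq ι]

/-- The modulus of the weight of a voter whose peers lean to the wrong side. -/
lemma abs_bias_le_quarter {a g r d y : ℝ} (hd : 0 ≤ |a| * (1 - 2 * g))
    (hy : y = |2 * a * g + r| + 2 * |a| * g)
    (hsmall : |a| * (1 - 2 * g) + d + 2 * max y 0 ≤ 1)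
    (hslack : 0 ≤ g ∨ 0 ≤ |a| * (1 - 2 * g) + d - |a| + 2 * g) (hd0 : 0 ≤ d)
    (hy6 : max y 0 ≤ 1 / 6) :
    |2 * a * g + r| ≤ 1 / 4 + max y 0 ^ 2 := by
  have h1 := le_max_left y 0
  have h2 := le_max_right y 0
  have ha0 := abs_nonneg a
  rcases le_or_gt 0 g with hg | hg
  · have : 0 ≤ |a| * g := mul_nonneg ha0 hg
    nlinarith
  · have hs := hslack.resolve_left (not_le.2 hg)
    generalize |2 * a * g + r| = e at *
    generalize |a| = b at *
    set A := b * (1 - 2 * g) + d with hA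
    -- The slack gives `-2 g ≤ A - b`, so `-2 b g ≤ A²/4 ≤ (1 - 2 y⁺)²/4`, with `y⁺ = max y 0`.
    -- Adding `y ≤ y⁺` leaves `1/4 + (y⁺)²`.
    have h3 : b * (-(2 * g)) ≤ b * (A - b) := mul_le_mul_of_nonneg_left (by linarith) ha0
    have h4 : b * (A - b) ≤ A ^ 2 / 4 := by nlinarith [sq_nonneg (A - 2 * b)]
    have hA0 : 0 ≤ A := by linarith
    have h5 : A ^ 2 ≤ (1 - 2 * max y 0) ^ 2 := by
      have : A ≤ 1 - 2 * max y 0 := by linarith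
      gcongr
    nlinarith

/-- The halved influence charges `1/2 |m i - e i|`, and the triangle inequality splits this into
half the defect and half the modulus of the deviation. -/
lemma signMean_voteErr_le_of_two (hcard : Fintype.card ι = 2) {m q : ι → ℝ}
    (hm : ∀ i, |m i| ≤ 1 / 2) (hq : ∀ i, 0 ≤ q i ∧ q i ≤ 1) (hqq : ∀ i j, q i = q j) :
    signMean m (voteErr fun i => naiveBayesWeight (q i)) ≤
      signMean (fun i => q i - 1 / 2) (voteErr fun i => naiveBayesWeight (q i)) +
        (1 / 2 * ∑ i, |m i| * (1 - 2 * peerBias m i) +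
          ∑ i, deviationCost (m i) (q i - 1 / 2 - 2 * m i * peerBias m i)) := by
  have he : ∀ i, |q i - 1 / 2| ≤ 1 / 2 := fun i => by
    rw [abs_le]; constructor <;> linarith [(hq i).1, (hq i).2]
  have h1 := signMean_piecewise_le (e := fun i => q i - 1 / 2)
    (D := fun i => 1 / 2 * |m i - (q i - 1 / 2)|) hm he
    (F := voteErr fun i => naiveBayesWeight (q i)) Finset.univ fun i _ n hn hni => by
      rw [← hni]; exact signMean_update_le_of_two hcard hn hqq i
  rw [Finset.piecewise_univ] at h1
  refine h1.trans (add_le_add le_rfl ?_)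
  rw [Finset.mul_sum, ← Finset.sum_add_distrib]
  refine Finset.sum_le_sum fun i _ => ?_
  have hg := abs_le.1 (abs_peerBias_le hm i)
  have h2 : |m i - (q i - 1 / 2)| ≤ |m i| * (1 - 2 * peerBias m i)
      + |q i - 1 / 2 - 2 * m i * peerBias m i| := by
    rw [← abs_of_nonneg (by linarith : 0 ≤ 1 - 2 * peerBias m i), ← abs_mul]
    refine le_trans (le_of_eq ?_) (abs_sub _ _)
    congr 1; ring
  have h3 := half_abs_le_deviationCost (m i) (q i - 1 / 2 - 2 * m i * peerBias m i)
  linarith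

/-- The error of the weighted vote with the weights of the competences `q`, in terms of the
potential of `q`, the defects of the pseudo competences `1 / 2 + 2 m g`, and the deviations of `q`
from the pseudo competences. -/
theorem signMean_voteErr_le {m q : ι → ℝ} {δ : ℝ} (hm : ∀ i, |m i| ≤ 1 / 2)
    (hq : ∀ i, 0 ≤ q i ∧ q i ≤ 1) (hqq : Fintype.card ι = 2 → ∀ i j, q i = q j) (hδ : δ < 1)
    (hA : ∑ i, |m i| * (1 - 2 * peerBias m i) ≤ δ)
    (hR : (∀ i, 0 < q i ∧ q i < 1) →
      Real.exp (-(∑ i, (q i - 1 / 2) * logit (q i - 1 / 2)) / 2) ≤ δ / 2) :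
    signMean m (voteErr fun i => naiveBayesWeight (q i)) ≤
      δ / 4 + 3 / 4 * ∑ i, |m i| * (1 - 2 * peerBias m i)
        + ∑ i, deviationCost (m i) (q i - 1 / 2 - 2 * m i * peerBias m i) := by
  set F : (ι → ℤˣ) → ℝ := voteErr fun i => naiveBayesWeight (q i) with hF
  set e : ι → ℝ := fun i => q i - 1 / 2 with he_def
  set r : ι → ℝ := fun i => q i - 1 / 2 - 2 * m i * peerBias m i with hr
  set A : ι → ℝ := fun i => |m i| * (1 - 2 * peerBias m i) with hA_def
  set c : ι → ℝ := fun i => deviationCost (m i) (r i) with hc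
  have her : ∀ i, e i = 2 * m i * peerBias m i + r i := fun i => by simp only [he_def, hr]; ring
  have hg : ∀ i, |peerBias m i| ≤ 1 / 2 := abs_peerBias_le hm
  have hA0 : ∀ i, 0 ≤ A i := fun i =>
    mul_nonneg (abs_nonneg _) (by have := (abs_le.1 (hg i)).2; linarith)
  have hc0 : ∀ i, 0 ≤ c i := fun i => deviationCost_nonneg _ _
  have he : ∀ i, |e i| ≤ 1 / 2 := fun i => by
    rw [abs_le]; constructor <;> simp only [he_def] <;> linarith [(hq i).1, (hq i).2]
  have hAs : 0 ≤ ∑ i, A i := Finset.sum_nonneg fun i _ => hA0 i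
  have hcs : 0 ≤ ∑ i, c i := Finset.sum_nonneg fun i _ => hc0 i
  have hδ0 : 0 ≤ δ := hAs.trans hA
  have hideal : signMean e F ≤ δ / 4 := signMean_voteErr_ideal_le hq hδ0 hR
  by_cases hcard2 : Fintype.card ι = 2
  · have := signMean_voteErr_le_of_two hcard2 hm hq (hqq hcard2)
    linarith
  -- From here on the claimed bound is below one. With `A ≤ δ` this makes the total defect plus the
  -- total deviation cost less than one, the smallness used below.
  by_cases hbig : 1 ≤ δ / 4 + 3 / 4 * ∑ i, A i + ∑ i, c i
  · exact (signMean_voteErr_le_one hm _).trans hbig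
  push Not at hbig
  have hslack : ∀ i, 0 ≤ peerBias m i ∨ 0 ≤ ∑ k, A k - |m i| + 2 * peerBias m i := by
    intro i
    by_cases hcard3 : 3 ≤ Fintype.card ι
    · exact Or.inr (defectSlack_nonneg hcard3 hm i)
    · left
      -- A single voter has no peers, its peer vote is a tie, and its `peerBias` is zero.
      have h0 : 0 < Fintype.card ι := Fintype.card_pos_iff.2 ⟨i⟩
      have h1 : Fintype.card ι = 1 := by omega
      have h2 : (Finset.univ.erase i : Finset ι) = ∅ := by
        rw [← Finset.card_eq_zero, Finset.card_erase_of_mem (Finset.mem_univ i),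
          Finset.card_univ, h1]
      have h3 : ∀ x, peerSign i x = 0 := fun x => by simp [peerSign, peerSum, h2]
      simp [peerBias, signMean, h3]
  have hstep : ∀ S : Finset ι, signMean m F
      ≤ signMean (S.piecewise e m) F + ∑ i ∈ S, switchCost (m i) (e i) := fun S =>
    signMean_piecewise_le hm he S fun i _ n hn hni => by
      rw [← hni]; exact signMean_update_le hn hq i
  set W : Finset ι := Finset.univ.filter fun i => m i * e i < 0 with hW
  have hWneg : ∀ i ∈ W, m i * (2 * m i * peerBias m i + r i) < 0 := fun i hi => by
    rw [← her]; exact (Finset.mem_filter.1 hi).2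
  set y : ι → ℝ := fun i => |e i| + 2 * |m i| * peerBias m i with hy
  have hWc : ∑ i ∈ Wᶜ, switchCost (m i) (e i) ≤ ∑ i ∈ Wᶜ, c i := by
    refine Finset.sum_le_sum fun i hi => ?_
    have : 0 ≤ m i * e i := by
      by_contra hcon
      exact (Finset.mem_compl.1 hi) (Finset.mem_filter.2 ⟨Finset.mem_univ i, not_le.1 hcon⟩)
    rw [her] at this ⊢
    exact switchCost_le (hg i) this
  have hcW : ∀ i ∈ W, c i = 2 * max (y i) 0 + max (-y i) 0 := fun i hi => by
    have := (wrong_sign_cost (hWneg i hi)).2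
    rw [← her] at this
    exact this
  have hsW : ∀ i ∈ W, switchCost (m i) (e i) = |m i| + |e i| := fun i hi => by
    have := (wrong_sign_cost (hWneg i hi)).1
    rwa [← her] at this
  have hae : ∀ i, |m i| + |e i| = A i + y i := fun i => by simp only [hA_def, hy]; ring
  have hsplitA := Finset.sum_add_sum_compl W A
  have hsplitc := Finset.sum_add_sum_compl W c
  have hAW0 : 0 ≤ ∑ i ∈ W, A i := Finset.sum_nonneg fun i _ => hA0 i
  have hAWc0 : 0 ≤ ∑ i ∈ Wᶜ, A i := Finset.sum_nonneg fun i _ => hA0 i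
  have hcWc0 : 0 ≤ ∑ i ∈ Wᶜ, c i := Finset.sum_nonneg fun i _ => hc0 i
  -- The condition says that the replacement cost `∑ (A i + y i)` on `W` is within the budget `∑
  -- (3/4 A i + c i)`.
  by_cases hcase : ∑ i ∈ W, A i ≤ 4 * ∑ i ∈ W, (c i - y i)
  · have h1 := hstep Finset.univ
    rw [Finset.piecewise_univ, ← Finset.sum_add_sum_compl W, Finset.sum_congr rfl hsW,
      Finset.sum_congr rfl fun i _ => hae i, Finset.sum_add_distrib] at h1
    rw [Finset.sum_sub_distrib] at hcase
    linarith
  push Not at hcase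
  have hZ : ∑ i ∈ W, max (y i) 0 ≤ ∑ i ∈ W, (c i - y i) := Finset.sum_le_sum fun i hi => by
    rw [hcW i hi]
    rcases le_total (y i) 0 with h | h
    · rw [max_eq_right h, max_eq_left (by linarith)]; linarith
    · rw [max_eq_left h, max_eq_right (by linarith)]; linarith
  have hY2 : 2 * ∑ i ∈ W, max (y i) 0 ≤ ∑ i ∈ W, c i := by
    rw [Finset.mul_sum]
    exact Finset.sum_le_sum fun i hi => by
      rw [hcW i hi]; linarith [le_max_right (-y i) 0]
  have hYi : ∀ i ∈ W, max (y i) 0 ≤ ∑ i ∈ W, max (y i) 0 := fun i hi =>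
    Finset.single_le_sum (f := fun i => max (y i) 0) (fun i _ => le_max_right _ _) hi
  -- With `Z = ∑ max (y i) 0` over `W`, the failure of `hcase` gives `4 Z < ∑ A i`, and `2 Z ≤ ∑ c
  -- i`; since defect and cost together are below one, `6 Z < 1`.
  have hy6 : ∀ i ∈ W, max (y i) 0 ≤ 1 / 6 := fun i hi => by
    have := hYi i hi
    linarith
  have heW : ∀ i ∈ W, |e i| ≤ 1 / 4 + max (y i) 0 ^ 2 := fun i hi => by
    have hle : A i ≤ ∑ k, A k := Finset.single_le_sum (fun k _ => hA0 k) (Finset.mem_univ i)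
    have hi1 := hYi i hi
    rw [her]
    refine abs_bias_le_quarter (d := ∑ k, A k - A i) (hA0 i) (by simp only [hy, her]) ?_ ?_
      (by linarith) (hy6 i hi)
    · change A i + _ + _ ≤ 1
      linarith
    · change _ ∨ 0 ≤ A i + _ - _ + _
      have : A i + (∑ k, A k - A i) = ∑ k, A k := by ring
      rw [this]
      exact hslack i
  have h1 := hstep Wᶜ
  set n : ι → ℝ := Wᶜ.piecewise e m with hn
  have hnW : ∀ i ∈ W, n i = m i := fun i hi =>
    Finset.piecewise_eq_of_notMem _ _ _ (by simpa using hi)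
  have hnWc : ∀ i, i ∉ W → n i = e i := fun i hi =>
    Finset.piecewise_eq_of_mem _ _ _ (Finset.mem_compl.2 hi)
  have hB := prod_correction_mul_le W (a := fun i => |m i|) (e := fun i => |e i|)
    (y := fun i => max (y i) 0) (fun i _ => abs_nonneg _) (fun i _ => hm i)
    (fun i _ => abs_nonneg _) (fun i _ => le_max_right _ _) hy6 heW (by
      rw [Finset.sum_congr rfl fun i _ => hae i, Finset.sum_add_distrib]
      rw [Finset.sum_sub_distrib] at hZ
      have : 0 ≤ ∑ i ∈ W, max (y i) 0 := Finset.sum_nonneg fun i _ => le_max_right _ _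
      linarith)
  have hfin : 1 + 3 * ∑ i ∈ W, (|m i| + |e i|) + 5 / 2 * ∑ i ∈ W, max (y i) 0
      ≤ 1 + 3 * ∑ i ∈ W, A i + 4 * ∑ i ∈ W, c i := by
    rw [Finset.sum_congr rfl fun i _ => hae i, Finset.sum_add_distrib]
    have : 3 * ∑ i ∈ W, y i + 5 / 2 * ∑ i ∈ W, max (y i) 0 ≤ 4 * ∑ i ∈ W, c i := by
      rw [Finset.mul_sum, Finset.mul_sum, Finset.mul_sum, ← Finset.sum_add_distrib]
      refine Finset.sum_le_sum fun i hi => ?_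
      rw [hcW i hi]
      linarith [le_max_left (y i) 0, le_max_right (y i) 0, le_max_right (-y i) 0]
    linarith
  have hcWs : 0 ≤ ∑ i ∈ W, c i := Finset.sum_nonneg fun i _ => hc0 i
  have h2 := signMean_voteErr_le_of_eq_off (n := n) (δ := δ) W hq
    (fun i hi => by rw [hnW i hi]; exact hm i) hnWc
    (fun i hi => by
      have h3 := heW i hi
      have h4 := hy6 i hi
      have h5 := le_max_right (y i) 0
      have h6 : |e i| < 1 / 2 := by nlinarith
      have h7 := abs_lt.1 h6
      simp only [he_def] at h7
      constructor <;> linarith [h7.1, h7.2])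
    (fun i hi => by rw [hnW i hi]; exact (Finset.mem_filter.1 hi).2.le) hδ0 hR
    (B := 1 + 3 * ∑ i ∈ W, A i + 4 * ∑ i ∈ W, c i) (by linarith) (by
      have p1 : ∏ i ∈ W, (1 + 4 * |n i| * |e i|) = ∏ i ∈ W, (1 + 4 * |m i| * |e i|) :=
        Finset.prod_congr rfl fun i hi => by rw [hnW i hi]
      have p2 : ∏ i ∈ W, (1 - 4 * |n i| * |e i|) = ∏ i ∈ W, (1 - 4 * |m i| * |e i|) :=
        Finset.prod_congr rfl fun i hi => by rw [hnW i hi]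
      have p3 : ∏ i ∈ W, (1 - 2 * |n i|) = ∏ i ∈ W, (1 - 2 * |m i|) :=
        Finset.prod_congr rfl fun i hi => by rw [hnW i hi]
      change _ * (∏ i ∈ W, (1 + 4 * |n i| * |e i|) + ∏ i ∈ W, (1 - 4 * |n i| * |e i|) - _) ≤ _
      rw [p1, p2, p3]
      exact hB.trans hfin)
  -- The factor `δ < 1` is dropped from all terms but the first.
  have h3 : δ / 4 * (1 + 3 * ∑ i ∈ W, A i + 4 * ∑ i ∈ W, c i)
      ≤ δ / 4 + 3 / 4 * ∑ i ∈ W, A i + ∑ i ∈ W, c i := by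
    nlinarith
  linarith

end ErrorBound

/-! ### The law of the state, the opinions and a tie value on one task. -/

section SingleTask

/-- The sign of an integer with values in `{-1, 1}`. -/
def toSign (z : ℤ) : ℤˣ := if z = 1 then 1 else -1

lemma coe_toSign {z : ℤ} (hz : z = -1 ∨ z = 1) : ((toSign z : ℤˣ) : ℤ) = z := by
  rcases hz with rfl | rfl <;> simp [toSign]

@[simp] lemma toSign_coe (u : ℤˣ) : toSign (u : ℤ) = u := by
  rcases Int.units_eq_one_or u with rfl | rfl <;> simp [toSign]

lemma units_val_mem (u : ℤˣ) : (u : ℤ) = -1 ∨ (u : ℤ) = 1 := by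
  rcases Int.units_eq_one_or u with rfl | rfl <;> simp

variable {Ω : Type*} [MeasurableSpace Ω] {P : Measure Ω} [IsProbabilityMeasure P]
  {N T : ℕ} {p : Fin N → ℝ} {Y : ℕ → Ω → ℤ} {X : Fin N → ℕ → Ω → ℤ}
  {U : Fin N → ℕ → Ω → ℤ} {C : ℕ → Ω → ℤ}

namespace IsExpertModel

lemma measureReal_state (hM : IsExpertModel P T p Y X U C) {t : ℕ} (ht : t ∈ Finset.Icc 1 T)
    (y : ℤˣ) : P.real {ω | Y t ω = y} = 1 / 2 := by
  rcases Int.units_eq_one_or y with rfl | rfl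
  · exact (hM.uniform_prior t ht).1
  · exact (hM.uniform_prior t ht).2

lemma measurableSet_state (hM : IsExpertModel P T p Y X U C) {t : ℕ} (ht : t ∈ Finset.Icc 1 T)
    (y : ℤ) : MeasurableSet {ω | Y t ω = y} :=
  hM.measurable_state t ht (measurableSet_singleton y)

lemma isProbabilityMeasure_cond (hM : IsExpertModel P T p Y X U C) {t : ℕ}
    (ht : t ∈ Finset.Icc 1 T) (y : ℤˣ) : IsProbabilityMeasure (P[|{ω | Y t ω = y}]) := by
  refine cond_isProbabilityMeasure fun h => ?_
  have := hM.measureReal_state ht y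
  rw [measureReal_def, h] at this
  norm_num at this

lemma abs_competence_sub_le (hM : IsExpertModel P T p Y X U C) {t : ℕ}
    (ht : t ∈ Finset.Icc 1 T) (i : Fin N) : |p i - 1 / 2| ≤ 1 / 2 := by
  have := hM.isProbabilityMeasure_cond ht 1
  have h := hM.competence i t ht 1 (Or.inr rfl)
  have h0 : 0 ≤ p i := by rw [← h]; exact measureReal_nonneg
  have h1 : p i ≤ 1 := by rw [← h]; exact measureReal_le_one
  rw [abs_le]; constructor <;> linarith

lemma cond_measureReal_opinion (hM : IsExpertModel P T p Y X U C) {t : ℕ}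
    (ht : t ∈ Finset.Icc 1 T) (y u : ℤˣ) (i : Fin N) :
    (P[|{ω | Y t ω = y}]).real {ω | X i t ω = (y : ℤ) * u} = 1 / 2 + (p i - 1 / 2) * signVal u := by
  have := hM.isProbabilityMeasure_cond ht y
  have hy := hM.measurableSet_state ht y
  have hcorrect : (P[|{ω | Y t ω = y}]).real {ω | X i t ω = y} = p i := by
    rw [← hM.competence i t ht y (units_val_mem y), measureReal_def, measureReal_def,
      cond_apply hy, cond_apply hy]
    congr 3
    ext ω
    simp only [Set.mem_inter_iff, Set.mem_ofPred_eq]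
    constructor
    · rintro ⟨h1, h2⟩; exact ⟨h1, by rw [h1, h2]⟩
    · rintro ⟨h1, h2⟩; exact ⟨h1, by rw [← h1, h2]⟩
  rcases Int.units_eq_one_or u with rfl | rfl
  · simp [hcorrect]
  · have hset : {ω | X i t ω = (y : ℤ) * ((-1 : ℤˣ) : ℤ)} = {ω | X i t ω = y}ᶜ := by
      ext ω
      have h1 := hM.opinion_mem i t ht ω
      have h2 := units_val_mem y
      simp only [Set.mem_ofPred_eq, Set.mem_compl_iff, Units.val_neg, Units.val_one, mul_neg, mul_one]
      omega
    rw [hset, measureReal_compl (show MeasurableSet {ω | X i t ω = (y : ℤ)} from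
      hM.measurable_opinion i t ht (measurableSet_singleton _)),
      hcorrect]
    simp; ring

/-- The joint law of the state and the opinions on a task. -/
lemma measureReal_state_opinion (hM : IsExpertModel P T p Y X U C) {t : ℕ}
    (ht : t ∈ Finset.Icc 1 T) (y : ℤˣ) (x : Fin N → ℤˣ) :
    P.real {ω | Y t ω = y ∧ ∀ i, X i t ω = (y : ℤ) * x i}
      = 1 / 2 * signMass (fun i => p i - 1 / 2) x := by
  have hy := hM.measurableSet_state ht y
  have hind := hM.opinions_condIndep t ht y (units_val_mem y)
  have h1 := hind.measure_inter_preimage_eq_mul Finset.univ (sets := fun i => {(y : ℤ) * x i})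
    fun i _ => measurableSet_singleton _
  have h2 : (P[|{ω | Y t ω = y}]).real (⋂ i, {ω | X i t ω = (y : ℤ) * x i})
      = signMass (fun i => p i - 1 / 2) x := by
    have h3 : (⋂ i, {ω | X i t ω = (y : ℤ) * x i})
        = ⋂ i ∈ (Finset.univ : Finset (Fin N)), X i t ⁻¹' {(y : ℤ) * x i} := by
      ext ω; simp
    rw [measureReal_def, h3, h1, ENNReal.toReal_prod]
    exact Finset.prod_congr rfl fun i _ => hM.cond_measureReal_opinion ht y (x i) i
  rw [measureReal_def, cond_apply hy, ENNReal.toReal_mul, ENNReal.toReal_inv, ← measureReal_def,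
    hM.measureReal_state ht, ← measureReal_def] at h2
  rw [← h2]
  have h4 : {ω | Y t ω = y ∧ ∀ i, X i t ω = (y : ℤ) * x i}
      = {ω | Y t ω = y} ∩ ⋂ i, {ω | X i t ω = (y : ℤ) * x i} := by
    ext ω; simp
  rw [h4]; ring

/-- The probability of an event that depends on the state, the opinions and an independent
tie value `Z` of a task. `k x` is the fraction of the two states for which the event occurs if `x`
tells which experts are right. -/
lemma measureReal_eq_signMean (hM : IsExpertModel P T p Y X U C) {t : ℕ}
    (ht : t ∈ Finset.Icc 1 T) {Z : Ω → ℤ} (hZ : Measurable Z) (hZmem : ∀ ω, Z ω = -1 ∨ Z ω = 1)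
    (hind : IndepFun (fun ω => (Y t ω, fun i => X i t ω)) Z P)
    (S : ℤ → (Fin N → ℤ) → ℤ → Prop) [∀ y x z, Decidable (S y x z)] (k : (Fin N → ℤˣ) → ℝ)
    (hk : ∀ (x : Fin N → ℤˣ) (c : ℤˣ), (if S 1 (fun i => x i) c then (1 : ℝ) else 0)
      + (if S (-1) (fun i => -x i) c then (1 : ℝ) else 0) = 2 * k x) :
    P.real {ω | S (Y t ω) (fun i => X i t ω) (Z ω)} = signMean (fun i => p i - 1 / 2) k := by
  classical
  -- State, correctness pattern (state times opinions) and tie value are independent and the state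
  -- is uniform. Adding the two states for a fixed pattern therefore leaves `k`, and the law of the
  -- tie value sums to one.
  set V : Ω → ℤˣ × (Fin N → ℤˣ) × ℤˣ := fun ω =>
    (toSign (Y t ω), fun i => toSign (Y t ω) * toSign (X i t ω), toSign (Z ω)) with hV
  have hpre : ∀ (y : ℤˣ) (x : Fin N → ℤˣ) (c : ℤˣ), V ⁻¹' {(y, x, c)}
      = {ω | Y t ω = y ∧ ∀ i, X i t ω = (y : ℤ) * x i} ∩ {ω | Z ω = c} := by
    intro y x c
    ext ω
    simp only [hV, Set.mem_preimage, Set.mem_singleton_iff, Prod.mk.injEq, Set.mem_inter_iff,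
      Set.mem_ofPred_eq]
    constructor
    · rintro ⟨h1, h2, h3⟩
      refine ⟨⟨?_, fun i => ?_⟩, ?_⟩
      · rw [← h1, coe_toSign (hM.state_mem t ht ω)]
      · rw [← h2, ← h1, ← Units.val_mul, ← mul_assoc, Int.units_mul_self, one_mul,
          coe_toSign (hM.opinion_mem i t ht ω)]
      · rw [← h3, coe_toSign (hZmem ω)]
    · rintro ⟨⟨h1, h2⟩, h3⟩
      refine ⟨by rw [h1, toSign_coe], ?_, by rw [h3, toSign_coe]⟩
      funext i
      rw [h1, h2, ← Units.val_mul, toSign_coe, toSign_coe, ← mul_assoc, Int.units_mul_self, one_mul]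
  have hdata : ∀ (y : ℤˣ) (x : Fin N → ℤˣ), {ω | Y t ω = y ∧ ∀ i, X i t ω = (y : ℤ) * x i}
      = (fun ω => (Y t ω, fun i => X i t ω)) ⁻¹' {((y : ℤ), fun i => (y : ℤ) * x i)} := by
    intro y x
    ext ω
    simp [funext_iff]
  have hmeasD : Measurable fun ω => (Y t ω, fun i => X i t ω) :=
    (hM.measurable_state t ht).prodMk (measurable_pi_lambda _ fun i => hM.measurable_opinion i t ht)
  have hmeas : ∀ v, MeasurableSet (V ⁻¹' {v}) := by
    rintro ⟨y, x, c⟩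
    rw [hpre, hdata]
    exact (hmeasD (measurableSet_singleton _)).inter (hZ (measurableSet_singleton _))
  have hprob : ∀ (y : ℤˣ) (x : Fin N → ℤˣ) (c : ℤˣ), P.real (V ⁻¹' {(y, x, c)})
      = 1 / 2 * signMass (fun i => p i - 1 / 2) x * P.real {ω | Z ω = c} := by
    intro y x c
    rw [← hM.measureReal_state_opinion ht y x, hpre, hdata]
    have := hind.measure_inter_preimage_eq_mul {((y : ℤ), fun i => (y : ℤ) * x i)} {(c : ℤ)}
      (measurableSet_singleton _) (measurableSet_singleton _)
    rw [measureReal_def, measureReal_def, measureReal_def, ← ENNReal.toReal_mul]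
    exact congrArg ENNReal.toReal this
  have hZsum : P.real {ω | Z ω = 1} + P.real {ω | Z ω = -1} = 1 := by
    have hset : {ω | Z ω = -1} = {ω | Z ω = 1}ᶜ := by
      ext ω
      have := hZmem ω
      simp only [Set.mem_ofPred_eq, Set.mem_compl_iff]
      omega
    rw [hset, measureReal_compl (show MeasurableSet {ω | Z ω = 1} from hZ (measurableSet_singleton 1))]
    simp
  have hevent : {ω | S (Y t ω) (fun i => X i t ω) (Z ω)} = V ⁻¹' ↑(Finset.univ.filter
      fun v : ℤˣ × (Fin N → ℤˣ) × ℤˣ => S v.1 (fun i => (v.1 : ℤ) * v.2.1 i) v.2.2) := by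
    ext ω
    simp only [hV, Set.mem_ofPred_eq, Set.mem_preimage, Finset.coe_filter, Finset.mem_univ,
      true_and]
    have h1 : ∀ i, ((toSign (Y t ω) : ℤˣ) : ℤ) * ((toSign (Y t ω) * toSign (X i t ω) : ℤˣ) : ℤ)
        = X i t ω := fun i => by
      rw [← Units.val_mul, ← mul_assoc, Int.units_mul_self, one_mul,
        coe_toSign (hM.opinion_mem i t ht ω)]
    simp only [h1]
    simp only [coe_toSign (hM.state_mem t ht ω), coe_toSign (hZmem ω)]
  rw [hevent, ← sum_measureReal_preimage_singleton _ fun v _ => hmeas v, Finset.sum_filter,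
    Fintype.sum_prod_type, UnitsInt.univ, Finset.sum_pair (by decide), ← Finset.sum_add_distrib,
    Fintype.sum_prod_type, signMean]
  refine Finset.sum_congr rfl fun x _ => ?_
  have hterm : ∀ c : ℤˣ, (if S ((1 : ℤˣ) : ℤ) (fun i => ((1 : ℤˣ) : ℤ) * x i) c
        then P.real (V ⁻¹' {(1, x, c)}) else 0)
      + (if S ((-1 : ℤˣ) : ℤ) (fun i => ((-1 : ℤˣ) : ℤ) * x i) c
        then P.real (V ⁻¹' {(-1, x, c)}) else 0)
      = signMass (fun i => p i - 1 / 2) x * k x * P.real {ω | Z ω = c} := by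
    intro c
    rw [hprob, hprob]
    have := hk x c
    simp only [Units.val_one, one_mul, Units.val_neg, neg_mul]
    split_ifs at this ⊢ <;> linear_combination
      (1 / 2 * signMass (fun i => p i - 1 / 2) x * P.real {ω | Z ω = c}) * this
  rw [Finset.sum_congr rfl fun c _ => hterm c, sum_sign]
  simp only [Units.val_one, Units.val_neg]
  rw [← mul_add, hZsum, mul_one]

end IsExpertModel

end SingleTask

/-! ### Error and agreement probabilities as expectations over sign vectors. -/

section Rules

variable {N : ℕ}

lemma signMean_add_mul (m : Fin N → ℝ) (a b : ℝ) (F : (Fin N → ℤˣ) → ℝ) :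
    signMean m (fun x => a + b * F x) = a + b * signMean m F := by
  unfold signMean
  simp_rw [mul_add, Finset.sum_add_distrib]
  rw [← Finset.sum_mul, sum_signMass, one_mul, Finset.mul_sum]
  congr 1
  exact Finset.sum_congr rfl fun x _ => by ring

lemma posWeight_neg (w : Fin N → EReal) (x : Fin N → ℤˣ) : posWeight w (-x) = negWeight w x :=
  Finset.sum_congr rfl fun i _ => by simp

lemma negWeight_neg (w : Fin N → EReal) (x : Fin N → ℤˣ) : negWeight w (-x) = posWeight w x :=
  Finset.sum_congr rfl fun i _ => by simp

lemma weightedVote_sign (w : Fin N → EReal) (x : Fin N → ℤˣ) (c : ℤ) :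
    weightedVote w (fun i => (x i : ℤ)) c =
      if negWeight w x < posWeight w x then 1
      else if posWeight w x < negWeight w x then -1 else c := rfl

lemma weightedVote_neg_sign (w : Fin N → EReal) (x : Fin N → ℤˣ) (c : ℤ) :
    weightedVote w (fun i => -(x i : ℤ)) c =
      if posWeight w x < negWeight w x then 1
      else if negWeight w x < posWeight w x then -1 else c := by
  rw [← posWeight_neg, ← negWeight_neg, ← weightedVote_sign]
  simp

lemma peerVote_sign (x : Fin N → ℤˣ) (i : Fin N) (c : ℤ) :
    peerVote (fun j => (x j : ℤ)) i c = signTie (peerSum i x) c := rfl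

lemma peerVote_neg_sign (x : Fin N → ℤˣ) (i : Fin N) (c : ℤ) :
    peerVote (fun j => -(x j : ℤ)) i c = signTie (-peerSum i x) c := by
  rw [peerVote, peerSum, Finset.sum_neg_distrib]

variable {Ω : Type*} [MeasurableSpace Ω] {P : Measure Ω} [IsProbabilityMeasure P]
  {T : ℕ} {p : Fin N → ℝ} {Y : ℕ → Ω → ℤ} {X : Fin N → ℕ → Ω → ℤ}
  {U : Fin N → ℕ → Ω → ℤ} {C : ℕ → Ω → ℤ}

namespace IsExpertModel

/-- The error probability of a weighted vote with deterministic weights. -/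
lemma measureReal_weightedVote_ne (hM : IsExpertModel P T p Y X U C) {t : ℕ}
    (ht : t ∈ Finset.Icc 1 T) (w : Fin N → EReal) :
    P.real {ω | weightedVote w (fun i => X i t ω) (C t ω) ≠ Y t ω}
      = signMean (fun i => p i - 1 / 2) (voteErr w) := by
  refine hM.measureReal_eq_signMean ht (hM.measurable_ruleTie t ht) (hM.ruleTie_mem t ht)
    ((hM.ties_indep t ht).comp measurable_id measurable_fst)
    (fun y x c => weightedVote w x c ≠ y) _ fun x c => ?_
  rw [weightedVote_sign, weightedVote_neg_sign, voteErr]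
  by_cases h1 : negWeight w x < posWeight w x
  · simp [h1, h1.not_gt]
  · by_cases h2 : posWeight w x < negWeight w x
    · simp [h1, h2]; norm_num
    · rcases Int.units_eq_one_or c with rfl | rfl <;> simp [h1, h2]

/-- The probability that an expert agrees with the majority of its peers. -/
lemma measureReal_agree (hM : IsExpertModel P T p Y X U C) {t : ℕ}
    (ht : t ∈ Finset.Icc 1 T) (i : Fin N) :
    P.real {ω | X i t ω = peerVote (fun j => X j t ω) i (U i t ω)}
      = 1 / 2 + 2 * (p i - 1 / 2) * peerBias (fun i => p i - 1 / 2) i := by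
  have hind : IndepFun (fun ω => (Y t ω, fun i => X i t ω)) (U i t) P :=
    (hM.ties_indep t ht).comp measurable_id ((measurable_pi_apply i).comp measurable_snd)
  have h1 := hM.measureReal_eq_signMean ht (hM.measurable_voteTie i t ht) (hM.voteTie_mem i t ht)
    hind (fun _ x c => x i = peerVote x i c)
    (fun x => 1 / 2 + 1 / 2 * (signVal (x i) * peerSign i x)) fun x c => by
      simp only
      rw [peerVote_sign, peerVote_neg_sign, peerSign]
      rcases intSign_cases (peerSum i x) with ⟨h, h'⟩ | ⟨h, h'⟩ | ⟨h, h'⟩ <;> rw [h'] <;>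
        rcases Int.units_eq_one_or (x i) with hx | hx <;>
        rcases Int.units_eq_one_or c with hc | hc <;>
        simp [signTie, h, h.not_gt, hx, hc] <;> norm_num
  rw [h1]
  have h2 := signMean_signVal_mul (fun i => p i - 1 / 2) i fun x => peerSign_flipAt i x
  rw [signMean_add_mul, h2, peerBias]; ring

end IsExpertModel

end Rules

/-! ### Mean deviation of averages, and conditioning on the past. -/

section Concentration

/-- The mean absolute deviation of an average of independent `[0, 1]`-valued variables. -/
lemma integral_abs_average_sub_le {Ω : Type*} [MeasurableSpace Ω] {P : Measure Ω}
    [IsProbabilityMeasure P] {κ : Type*} [DecidableEq κ] {S : Finset κ} {n : ℕ} (hn : S.card = n)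
    (hn0 : 0 < n) {Z : κ → Ω → ℝ} (hZ : ∀ s ∈ S, Measurable (Z s))
    (hZ01 : ∀ s ∈ S, ∀ ω, Z s ω ∈ Set.Icc (0 : ℝ) 1)
    (hind : Set.Pairwise (S : Set κ) fun s s' => IndepFun (Z s) (Z s') P) {c : ℝ}
    (hc : ∀ s ∈ S, ∫ ω, Z s ω ∂P = c) :
    Integrable (fun ω => (∑ s ∈ S, Z s ω) / n - c) P ∧ ∫ ω, ((∑ s ∈ S, Z s ω) / n - c) ∂P = 0 ∧
      ∫ ω, |(∑ s ∈ S, Z s ω) / n - c| ∂P ≤ 1 / (2 * √(n : ℝ)) := by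
  have hLp : ∀ s ∈ S, MemLp (Z s) 2 P := fun s hs =>
    MemLp.of_bound (hZ s hs).aestronglyMeasurable 1 (Filter.Eventually.of_forall fun ω => by
      rw [Real.norm_eq_abs, abs_le]
      have := hZ01 s hs ω
      constructor <;> linarith [this.1, this.2])
  have hint : ∀ s ∈ S, Integrable (Z s) P := fun s hs => (hLp s hs).integrable (by norm_num)
  have hn' : (0 : ℝ) < n := by exact_mod_cast hn0
  set F : Ω → ℝ := fun ω => ∑ s ∈ S, Z s ω with hF
  have hFint : Integrable F P := integrable_finsetSum _ hint
  have hFmean : ∫ ω, F ω ∂P = n * c := by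
    rw [hF, integral_finsetSum _ hint, Finset.sum_congr rfl hc, Finset.sum_const, hn, nsmul_eq_mul]
  have hR : Integrable (fun ω => F ω / n - c) P := (hFint.div_const _).sub (integrable_const c)
  have hmean : ∫ ω, (F ω / n - c) ∂P = 0 := by
    rw [integral_sub (hFint.div_const _) (integrable_const c), integral_div, hFmean]
    simp
    field_simp
    simp
  refine ⟨hR, hmean, ?_⟩
  have hFLp : MemLp F 2 P := memLp_finsetSum _ hLp
  -- A variable with values in `[0, 1]` has variance at most `1/4`.
  have hvar : variance F P ≤ n / 4 := by
    have h1 : F = ∑ s ∈ S, Z s := by ext ω; simp [hF]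
    rw [h1, IndepFun.variance_sum hLp hind]
    calc ∑ s ∈ S, variance (Z s) P ≤ ∑ s ∈ S, ((1 - 0) / 2 : ℝ) ^ 2 :=
          Finset.sum_le_sum fun s hs => variance_le_sq_of_bounded
            (Filter.Eventually.of_forall (hZ01 s hs)) (hZ s hs).aemeasurable
      _ = n / 4 := by rw [Finset.sum_const, hn, nsmul_eq_mul]; ring
  have hRLp : MemLp (fun ω => F ω / n - c) 2 P := by
    simp only [div_eq_inv_mul]
    exact (hFLp.const_mul (n : ℝ)⁻¹).sub (memLp_const c)
  have hsq : ∫ ω, (F ω / n - c) ^ 2 ∂P ≤ 1 / (4 * n) := by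
    have h1 : variance F P = ∫ ω, (n * (F ω / n - c)) ^ 2 ∂P := by
      rw [variance_eq_integral hFint.aemeasurable, hFmean]
      congr 1
      ext ω
      congr 1
      field_simp
    have h2 : ∫ ω, (n * (F ω / n - c)) ^ 2 ∂P = n ^ 2 * ∫ ω, (F ω / n - c) ^ 2 ∂P := by
      rw [← integral_const_mul]
      congr 1
      ext ω; ring
    rw [h1, h2] at hvar
    rw [le_div_iff₀ (by positivity)]
    have : n * (n * ∫ ω, (F ω / n - c) ^ 2 ∂P) ≤ n * (1 / 4) := by nlinarith
    have := le_of_mul_le_mul_left this hn'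
    linarith
  have habs : (∫ ω, |F ω / n - c| ∂P) ^ 2 ≤ ∫ ω, (F ω / n - c) ^ 2 ∂P := by
    have h1 := variance_nonneg (fun ω => |F ω / n - c|) P
    rw [variance_eq_sub (show MemLp (fun ω => |F ω / n - c|) 2 P from hRLp.abs)] at h1
    have h2 : ∫ ω, ((fun ω => |F ω / n - c|) ^ 2) ω ∂P = ∫ ω, (F ω / n - c) ^ 2 ∂P := by
      congr 1; ext ω; simp
    rw [h2] at h1
    linarith
  have hsqrt : (1 / (2 * √(n : ℝ))) ^ 2 = 1 / (4 * n) := by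
    rw [div_pow, mul_pow, Real.sq_sqrt hn'.le]; norm_num
  exact abs_le_of_sq_le_sq' (by rw [hsqrt]; exact habs.trans hsq) (by positivity) |>.2

/-- Conditioning on a finitely valued variable that is independent of `D`. -/
lemma measureReal_le_integral_of_indepFun {Ω : Type*} [MeasurableSpace Ω] {P : Measure Ω}
    [IsProbabilityMeasure P] {β γ : Type*} [Fintype β] [MeasurableSpace β]
    [DiscreteMeasurableSpace β] [MeasurableSpace γ] {B : Ω → β} {D : Ω → γ} (hB : Measurable B)
    (hBD : IndepFun B D P) {Q : β → Set γ} (hQ : ∀ b, MeasurableSet (Q b)) {h : β → ℝ}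
    (hle : ∀ ω, P.real (D ⁻¹' Q (B ω)) ≤ h (B ω)) :
    P.real {ω | D ω ∈ Q (B ω)} ≤ ∫ ω, h (B ω) ∂P := by
  have h1 : {ω | D ω ∈ Q (B ω)} ⊆ ⋃ b, (B ⁻¹' {b} ∩ D ⁻¹' Q b) := fun ω hω =>
    Set.mem_iUnion.2 ⟨B ω, rfl, hω⟩
  have h2 : ∫ ω, h (B ω) ∂P = ∑ b, P.real (B ⁻¹' {b}) * h b := by
    have : IsProbabilityMeasure (P.map B) := Measure.isProbabilityMeasure_map hB.aemeasurable
    rw [← integral_map (φ := B) (f := h) hB.aemeasurable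
      (Measurable.of_discrete).aestronglyMeasurable, integral_fintype .of_finite]
    refine Finset.sum_congr rfl fun b _ => ?_
    rw [map_measureReal_apply hB (measurableSet_singleton b), smul_eq_mul]
  rw [h2]
  refine (measureReal_mono h1).trans ((measureReal_iUnion_fintype_le _).trans ?_)
  refine Finset.sum_le_sum fun b _ => ?_
  have h3 := hBD.measure_inter_preimage_eq_mul {b} (Q b) (measurableSet_singleton b) (hQ b)
  rw [measureReal_def, h3, ENNReal.toReal_mul]
  -- The bound `h` is only assumed at values that `B` attains; an unattained value has an empty
  -- fibre.
  rcases Set.eq_empty_or_nonempty (B ⁻¹' {b}) with h4 | ⟨ω, hω⟩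
  · simp [h4]
  · have h5 : B ω = b := hω
    have h6 := hle ω
    rw [h5] at h6
    exact mul_le_mul_of_nonneg_left h6 measureReal_nonneg

end Concentration

/-! ### The adaptive rule: independence of past and present, and the final average. -/

section AdaptiveRule

variable {Ω : Type*} [MeasurableSpace Ω] {P : Measure Ω} [IsProbabilityMeasure P]
  {N T : ℕ} {p : Fin N → ℝ} {Y : ℕ → Ω → ℤ} {X : Fin N → ℕ → Ω → ℤ}
  {U : Fin N → ℕ → Ω → ℤ} {C : ℕ → Ω → ℤ}

/-- The state, the opinions, and the tie values of a task. -/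
abbrev TaskData (N : ℕ) : Type := (ℤ × (Fin N → ℤ)) × (ℤ × (Fin N → ℤ))

/-- Whether expert `i` agrees with the majority vote of its peers. -/
noncomputable def agreement (i : Fin N) (d : TaskData N) : ℕ :=
  if d.1.2 i = peerVote d.1.2 i (d.2.2 i) then 1 else 0

/-- The data of task `t`. -/
def taskData (Y : ℕ → Ω → ℤ) (X U : Fin N → ℕ → Ω → ℤ) (C : ℕ → Ω → ℤ) (t : ℕ) (ω : Ω) :
    TaskData N :=
  ((Y t ω, fun i => X i t ω), (C t ω, fun i => U i t ω))

/-- The numbers of agreements of the experts with their peers on the first `τ` tasks. -/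
noncomputable def agreementCount (X U : Fin N → ℕ → Ω → ℤ) (τ : ℕ) (ω : Ω) (i : Fin N) :
    Fin (τ + 1) :=
  Fin.ofNat (τ + 1) (∑ s ∈ Finset.Icc 1 τ,
    if X i s ω = peerVote (fun j => X j s ω) i (U i s ω) then 1 else 0)

lemma empiricalPseudoCompetence_eq (X U : Fin N → ℕ → Ω → ℤ) (τ : ℕ) (ω : Ω) (i : Fin N) :
    empiricalPseudoCompetence X U τ ω i = ((agreementCount X U τ ω i : ℕ) : ℝ) / τ := by
  -- At most `τ` agreements occur, so the reduction modulo `τ + 1` in `agreementCount` changes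
  -- nothing.
  have hle : (∑ s ∈ Finset.Icc 1 τ,
      if X i s ω = peerVote (fun j => X j s ω) i (U i s ω) then 1 else 0) < τ + 1 := by
    refine Nat.lt_succ_of_le ((Finset.sum_le_sum (g := fun _ => 1) fun s _ => ?_).trans ?_)
    · split_ifs <;> norm_num
    · simp
  rw [agreementCount, Fin.val_ofNat, Nat.mod_eq_of_lt hle, empiricalPseudoCompetence]
  push_cast
  rfl

lemma empiricalPseudoCompetence_mem (X U : Fin N → ℕ → Ω → ℤ) (τ : ℕ) (ω : Ω) (i : Fin N) :
    0 ≤ empiricalPseudoCompetence X U τ ω i ∧ empiricalPseudoCompetence X U τ ω i ≤ 1 := by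
  rw [empiricalPseudoCompetence_eq]
  refine ⟨by positivity, div_le_one_of_le₀ ?_ (by positivity)⟩
  exact_mod_cast Nat.lt_succ_iff.1 (agreementCount X U τ ω i).2

/-- Two experts agree with each other on the same tasks. -/
lemma empiricalPseudoCompetence_congr (hN : N = 2) (X U : Fin N → ℕ → Ω → ℤ) (τ : ℕ) (ω : Ω)
    (hX : ∀ i, ∀ s ∈ Finset.Icc 1 τ, X i s ω = -1 ∨ X i s ω = 1) (i j : Fin N) :
    empiricalPseudoCompetence X U τ ω i = empiricalPseudoCompetence X U τ ω j := by
  subst hN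
  have key : ∀ i : Fin 2, empiricalPseudoCompetence X U τ ω i
      = (∑ s ∈ Finset.Icc 1 τ, if X 0 s ω = X 1 s ω then (1 : ℝ) else 0) / τ := by
    intro i
    unfold empiricalPseudoCompetence
    congr 1
    refine Finset.sum_congr rfl fun s hs => ?_
    have h0 := hX 0 s hs
    have h1 := hX 1 s hs
    have e0 : (Finset.univ.erase 0 : Finset (Fin 2)) = {1} := by decide
    have e1 : (Finset.univ.erase 1 : Finset (Fin 2)) = {0} := by decide
    fin_cases i
    · simp only [Fin.zero_eta, peerVote, e0, Finset.sum_singleton]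
      rcases h1 with h | h <;> simp [signTie, h]
    · simp only [Fin.mk_one, peerVote, e1, Finset.sum_singleton]
      rcases h0 with h | h <;> simp [signTie, h, eq_comm]
  rw [key i, key j]

lemma ereal_coe_sum {κ : Type*} (S : Finset κ) (f : κ → ℝ) :
    ((∑ i ∈ S, f i : ℝ) : EReal) = ∑ i ∈ S, (f i : EReal) := by
  classical
  induction S using Finset.induction_on with
  | empty => simp
  | insert i S hi ih => rw [Finset.sum_insert hi, Finset.sum_insert hi, EReal.coe_add, ih]

/-- The confidence event in terms of real exponentials. -/
lemma exp_potential_le_of_mem_confidenceEvent {X U : Fin N → ℕ → Ω → ℤ} {τ : ℕ} {δ : ℝ} {ω : Ω}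
    (hω : ω ∈ confidenceEvent X U τ δ) {q : Fin N → ℝ}
    (hqdef : q = empiricalPseudoCompetence X U τ ω) (hq : ∀ i, 0 < q i ∧ q i < 1) :
    Real.exp (-(∑ i, (q i - 1 / 2) * logit (q i - 1 / 2)) / 2) ≤ δ / 2 := by
  have h1 : EReal.exp (((-(1 / 2) : ℝ) : EReal) * committeePotential q)
      ≤ ENNReal.ofReal (δ / 2) := by rw [hqdef]; exact hω
  have h2 : committeePotential q = ((∑ i, (q i - 1 / 2) * logit (q i - 1 / 2) : ℝ) : EReal) := by
    rw [committeePotential, ereal_coe_sum]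
    refine Finset.sum_congr rfl fun i _ => ?_
    rw [naiveBayesWeight_eq_logit (hq i).1 (hq i).2, EReal.coe_mul]
  rw [h2, ← EReal.coe_mul, EReal.exp_coe, ENNReal.ofReal_le_ofReal_iff'] at h1
  refine le_trans (le_of_eq ?_) (h1.resolve_right (not_le.2 (Real.exp_pos _)))
  congr 1; ring

namespace IsExpertModel

lemma measurable_taskData (hM : IsExpertModel P T p Y X U C) {t : ℕ} (ht : t ∈ Finset.Icc 1 T) :
    Measurable (taskData Y X U C t) :=
  ((hM.measurable_state t ht).prodMk
    (measurable_pi_lambda _ fun i => hM.measurable_opinion i t ht)).prodMk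
    ((hM.measurable_ruleTie t ht).prodMk
      (measurable_pi_lambda _ fun i => hM.measurable_voteTie i t ht))

lemma indepFun_taskData (hM : IsExpertModel P T p Y X U C) {s t : ℕ} (hs : s ∈ Finset.Icc 1 T)
    (ht : t ∈ Finset.Icc 1 T) (hst : s ≠ t) :
    IndepFun (taskData Y X U C s) (taskData Y X U C t) P :=
  hM.tasks_indep.indepFun (i := ⟨s, hs⟩) (j := ⟨t, ht⟩) fun h => hst (congrArg Subtype.val h)

/-- The past is independent of the present. -/
lemma indepFun_agreementCount (hM : IsExpertModel P T p Y X U C) {τ t : ℕ} (hτt : τ < t)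
    (htT : t ≤ T) :
    Measurable (agreementCount X U τ) ∧
      IndepFun (agreementCount X U τ) (taskData Y X U C t) P := by
  classical
  have ht : t ∈ Finset.Icc 1 T := Finset.mem_Icc.2 ⟨by omega, htT⟩
  set S : Finset (Finset.Icc 1 T) := Finset.univ.filter fun s => s.1 ≤ τ with hS
  set S' : Finset (Finset.Icc 1 T) := {⟨t, ht⟩} with hS'
  have hdisj : Disjoint S S' := by
    rw [hS', Finset.disjoint_singleton_right, hS, Finset.mem_filter]
    rintro ⟨_, h⟩
    exact absurd h (not_le.2 hτt)
  have hmeas : ∀ s : Finset.Icc 1 T, Measurable (taskData Y X U C s.1) := fun s =>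
    hM.measurable_taskData s.2
  have hind := iIndepFun.indepFun_finset (f := fun s : Finset.Icc 1 T => taskData Y X U C s.1)
    S S' hdisj hM.tasks_indep hmeas
  have hmem : ∀ s ∈ Finset.Icc 1 τ, ∃ h : s ∈ Finset.Icc 1 T,
      (⟨s, h⟩ : Finset.Icc 1 T) ∈ S := fun s hs => by
    have := Finset.mem_Icc.1 hs
    exact ⟨Finset.mem_Icc.2 ⟨this.1, by omega⟩, Finset.mem_filter.2 ⟨Finset.mem_univ _, this.2⟩⟩
  let φ : (S → TaskData N) → Fin N → Fin (τ + 1) := fun d i =>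
    Fin.ofNat (τ + 1) (∑ s ∈ (Finset.Icc 1 τ).attach,
      agreement i (d ⟨⟨s.1, (hmem s.1 s.2).1⟩, (hmem s.1 s.2).2⟩))
  have hφ : Measurable φ := Measurable.of_discrete
  have hcount : agreementCount X U τ
      = φ ∘ fun ω (s : S) => taskData Y X U C s.1.1 ω := by
    funext ω i
    simp only [agreementCount, Function.comp, φ]
    congr 1
    rw [← Finset.sum_attach]
    rfl
  refine ⟨?_, ?_⟩
  · rw [hcount]
    exact hφ.comp (measurable_pi_lambda _ fun s => hmeas s.1)
  · rw [hcount]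
    exact hind.comp (ψ := fun d : S' → TaskData N => d ⟨⟨t, ht⟩, Finset.mem_singleton_self _⟩) hφ
      (measurable_pi_apply _)

/-- The empirical pseudo competence is unbiased, with mean absolute deviation at most
`1 / (2 √τ)`. -/
lemma integral_abs_empirical_sub_le (hM : IsExpertModel P T p Y X U C) {τ : ℕ} (hτ : 1 ≤ τ)
    (hτT : τ ≤ T) (i : Fin N) {c : ℝ}
    (hc : c = 1 / 2 + 2 * (p i - 1 / 2) * peerBias (fun i => p i - 1 / 2) i) :
    Integrable (fun ω => empiricalPseudoCompetence X U τ ω i - c) P ∧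
      ∫ ω, (empiricalPseudoCompetence X U τ ω i - c) ∂P = 0 ∧
      ∫ ω, |empiricalPseudoCompetence X U τ ω i - c| ∂P ≤ 1 / (2 * √(τ : ℝ)) := by
  have hsub : ∀ s ∈ Finset.Icc 1 τ, s ∈ Finset.Icc 1 T := fun s hs => by
    have := Finset.mem_Icc.1 hs
    exact Finset.mem_Icc.2 ⟨this.1, by omega⟩
  set g : TaskData N → ℝ := fun d =>
    if d.1.2 i = peerVote d.1.2 i (d.2.2 i) then 1 else 0 with hg
  have hgm : Measurable g := Measurable.of_discrete
  refine integral_abs_average_sub_le (S := Finset.Icc 1 τ)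
    (Z := fun s ω => g (taskData Y X U C s ω)) (by simp) hτ
    (fun s hs => hgm.comp (hM.measurable_taskData (hsub s hs))) (fun s _ ω => ?_)
    (fun s hs s' hs' hss => (hM.indepFun_taskData (hsub s hs) (hsub s' hs') hss).comp hgm hgm)
    fun s hs => ?_
  · simp only [hg]
    split_ifs <;> norm_num
  · have hset : MeasurableSet {d : TaskData N | d.1.2 i = peerVote d.1.2 i (d.2.2 i)} :=
      MeasurableSet.of_discrete
    have hpre := hM.measurable_taskData (hsub s hs) hset
    rw [hc, ← hM.measureReal_agree (hsub s hs) i]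
    have := integral_indicator_one (μ := P) hpre
    rw [show {ω | X i s ω = peerVote (fun j => X j s ω) i (U i s ω)} = taskData Y X U C s ⁻¹'
      {d : TaskData N | d.1.2 i = peerVote d.1.2 i (d.2.2 i)} from rfl, ← this]
    congr 1
    funext ω
    by_cases hω : ω ∈ taskData Y X U C s ⁻¹'
      {d : TaskData N | d.1.2 i = peerVote d.1.2 i (d.2.2 i)}
    · rw [Set.indicator_of_mem hω]
      exact if_pos hω
    · rw [Set.indicator_of_notMem hω]
      exact if_neg hω

end IsExpertModel

end AdaptiveRule

theorem theorem5 {Ω : Type*} [MeasurableSpace Ω] (P : Measure Ω) [IsProbabilityMeasure P]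
    {N T : ℕ} (p : Fin N → ℝ) (Y : ℕ → Ω → ℤ) (X : Fin N → ℕ → Ω → ℤ)
    (U : Fin N → ℕ → Ω → ℤ) (C : ℕ → Ω → ℤ) (hM : IsExpertModel P T p Y X U C)
    (s : ℕ) (hs : s ∈ Finset.Icc 1 T) (τ : ℕ) (hτ : 1 ≤ τ) (δ : ℝ)
    (hδ : ∑ i, |p i - pseudoCompetence P X U i s| + (N : ℝ) / √(τ : ℝ) ≤ δ) :
    ∀ t : ℕ, τ < t → t ≤ T →
      P.real (confidenceEvent X U τ δ ∩
        {ω | adaptiveRule X U τ ω (fun i => X i t ω) (C t ω) ≠ Y t ω}) ≤ δ := by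
  intro t hτt htT
  have ht : t ∈ Finset.Icc 1 T := Finset.mem_Icc.2 ⟨by omega, htT⟩
  rcases le_or_gt 1 δ with hδ1 | hδ1
  · exact measureReal_le_one.trans hδ1
  set m : Fin N → ℝ := fun i => p i - 1 / 2 with hm_def
  have hm : ∀ i, |m i| ≤ 1 / 2 := hM.abs_competence_sub_le ht
  set A : ℝ := ∑ i, |m i| * (1 - 2 * peerBias m i) with hA_def
  have hdefect : ∑ i, |p i - pseudoCompetence P X U i s| = A := by
    refine Finset.sum_congr rfl fun i _ => ?_
    have hg := (abs_le.1 (abs_peerBias_le hm i)).2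
    rw [pseudoCompetence, hM.measureReal_agree hs i,
      ← abs_of_nonneg (by linarith : 0 ≤ 1 - 2 * peerBias m i), ← abs_mul]
    congr 1
    simp only [hm_def]; ring
  rw [hdefect] at hδ
  have hτ0 : 0 < √(τ : ℝ) := Real.sqrt_pos.2 (by exact_mod_cast hτ)
  have hAδ : A ≤ δ := by
    have : 0 ≤ (N : ℝ) / √(τ : ℝ) := by positivity
    linarith
  have hA0 : 0 ≤ A := Finset.sum_nonneg fun i _ =>
    mul_nonneg (abs_nonneg _) (by have := (abs_le.1 (abs_peerBias_le hm i)).2; linarith)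
  -- The bound of `signMean_voteErr_le` as a function of the agreement counts, which determine the
  -- weights.
  set h : (Fin N → Fin (τ + 1)) → ℝ := fun b => δ / 4 + 3 / 4 * A
    + ∑ i, deviationCost (m i) (((b i : ℕ) : ℝ) / τ - 1 / 2 - 2 * m i * peerBias m i) with hh
  have hh0 : ∀ b, 0 ≤ h b := fun b => by
    have : 0 ≤ ∑ i, deviationCost (m i) (((b i : ℕ) : ℝ) / τ - 1 / 2 - 2 * m i * peerBias m i) :=
      Finset.sum_nonneg fun i _ => deviationCost_nonneg _ _
    simp only [hh]
    linarith
  set R : Set (Fin N → ℝ) := {q | EReal.exp (((-(1 / 2) : ℝ) : EReal) * committeePotential q)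
    ≤ ENNReal.ofReal (δ / 2)} with hR
  set Q : (Fin N → Fin (τ + 1)) → Set (TaskData N) := fun b =>
    {d | (fun i => ((b i : ℕ) : ℝ) / τ) ∈ R ∧
      weightedVote (fun i => naiveBayesWeight (((b i : ℕ) : ℝ) / τ)) d.1.2 d.2.1 ≠ d.1.1} with hQ
  obtain ⟨hB, hBD⟩ := hM.indepFun_agreementCount hτt htT
  have hemp : ∀ ω, empiricalPseudoCompetence X U τ ω
      = fun i => ((agreementCount X U τ ω i : ℕ) : ℝ) / τ := fun ω =>
    funext fun i => empiricalPseudoCompetence_eq X U τ ω i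
  have hevent : confidenceEvent X U τ δ ∩
      {ω | adaptiveRule X U τ ω (fun i => X i t ω) (C t ω) ≠ Y t ω}
      = {ω | taskData Y X U C t ω ∈ Q (agreementCount X U τ ω)} := by
    ext ω
    simp only [hQ, hR, confidenceEvent, adaptiveRule, taskData, Set.mem_inter_iff,
      Set.mem_ofPred_eq, hemp ω]
  have hle : ∀ ω, P.real (taskData Y X U C t ⁻¹' Q (agreementCount X U τ ω))
      ≤ h (agreementCount X U τ ω) := by
    intro ω
    -- Membership in the confidence event depends on the counts alone. Off it the event for task `t`
    -- is empty and only `0 ≤ h` is needed.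
    by_cases hω : ω ∈ confidenceEvent X U τ δ
    · have hsub : taskData Y X U C t ⁻¹' Q (agreementCount X U τ ω) ⊆ {ω' | weightedVote
          (fun i => naiveBayesWeight (((agreementCount X U τ ω i : ℕ) : ℝ) / τ))
          (fun i => X i t ω') (C t ω') ≠ Y t ω'} := fun ω' hω' => hω'.2
      refine (measureReal_mono hsub).trans ?_
      rw [hM.measureReal_weightedVote_ne ht]
      refine signMean_voteErr_le (q := fun i => ((agreementCount X U τ ω i : ℕ) : ℝ) / τ) hm
        (fun i => ?_) (fun hN i j => ?_) hδ1 hAδ fun hq => ?_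
      · rw [← empiricalPseudoCompetence_eq]
        exact empiricalPseudoCompetence_mem X U τ ω i
      · rw [← empiricalPseudoCompetence_eq, ← empiricalPseudoCompetence_eq]
        refine empiricalPseudoCompetence_congr (by simpa using hN) X U τ ω (fun i s hs => ?_) i j
        have := Finset.mem_Icc.1 hs
        exact hM.opinion_mem i s (Finset.mem_Icc.2 ⟨this.1, by omega⟩) ω
      · exact exp_potential_le_of_mem_confidenceEvent hω (hemp ω).symm hq
    · have hempty : taskData Y X U C t ⁻¹' Q (agreementCount X U τ ω) = ∅ := by
        refine Set.eq_empty_of_forall_notMem fun ω' hω' => hω ?_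
        have h1 : (fun i => ((agreementCount X U τ ω i : ℕ) : ℝ) / τ) ∈ R := hω'.1
        rw [← hemp ω] at h1
        exact h1
      rw [hempty, measureReal_empty]
      exact hh0 _
  rw [hevent]
  refine (measureReal_le_integral_of_indepFun hB hBD (fun b => MeasurableSet.of_discrete)
    hle).trans ?_
  have hdev : ∀ i, Integrable (fun ω => deviationCost (m i)
      (((agreementCount X U τ ω i : ℕ) : ℝ) / τ - 1 / 2 - 2 * m i * peerBias m i)) P ∧
      ∫ ω, deviationCost (m i)
        (((agreementCount X U τ ω i : ℕ) : ℝ) / τ - 1 / 2 - 2 * m i * peerBias m i) ∂P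
        ≤ 3 / 4 * (1 / √(τ : ℝ)) := by
    intro i
    obtain ⟨h1, h2, h3⟩ := hM.integral_abs_empirical_sub_le hτ (by omega) i rfl
    have h4 : (fun ω => deviationCost (m i)
        (((agreementCount X U τ ω i : ℕ) : ℝ) / τ - 1 / 2 - 2 * m i * peerBias m i))
        = fun ω => 3 / 2 * |empiricalPseudoCompetence X U τ ω i
            - (1 / 2 + 2 * (p i - 1 / 2) * peerBias (fun i => p i - 1 / 2) i)|
          - (if 0 ≤ m i then 1 / 2 else -1 / 2) * (empiricalPseudoCompetence X U τ ω i
            - (1 / 2 + 2 * (p i - 1 / 2) * peerBias (fun i => p i - 1 / 2) i)) := by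
      funext ω
      rw [deviationCost_eq, empiricalPseudoCompetence_eq, sub_sub]
    rw [h4]
    refine ⟨(h1.abs.const_mul _).sub (h1.const_mul _), ?_⟩
    rw [integral_sub (h1.abs.const_mul _) (h1.const_mul _), integral_const_mul,
      integral_const_mul, h2, mul_zero, sub_zero]
    calc _ ≤ 3 / 2 * (1 / (2 * √(τ : ℝ))) := mul_le_mul_of_nonneg_left h3 (by norm_num)
      _ = 3 / 4 * (1 / √(τ : ℝ)) := by field_simp; norm_num
  have hint : ∫ ω, h (agreementCount X U τ ω) ∂P = δ / 4 + 3 / 4 * A + ∑ i, ∫ ω,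
      deviationCost (m i)
        (((agreementCount X U τ ω i : ℕ) : ℝ) / τ - 1 / 2 - 2 * m i * peerBias m i) ∂P := by
    simp only [hh]
    rw [integral_add (integrable_const _) (integrable_finsetSum _ fun i _ => (hdev i).1),
      integral_finsetSum _ fun i _ => (hdev i).1]
    simp
  rw [hint]
  -- Altogether the bound is `δ/4 + 3/4 (A + N/√τ)`, at most `δ` by the hypothesis on `δ`.
  have hsum := Finset.sum_le_sum fun i (_ : i ∈ Finset.univ) => (hdev i).2
  rw [Finset.sum_const, Finset.card_univ, Fintype.card_fin, nsmul_eq_mul] at hsum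
  have : (N : ℝ) * (3 / 4 * (1 / √(τ : ℝ))) = 3 / 4 * ((N : ℝ) / √(τ : ℝ)) := by ring
  linarith
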